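/- Let $\mathfrak g_0$ be a finite-dimensional real Lie algebra with complexification $\mathfrak g=\mathfrak g_0^{\mathbb C}$. Let $G_0$ be a connected and simply connected real Lie group with Lie algebra $\mathfrak g_0$, let $G$ be a connected and simply connected complex Lie group with Lie algebra $\mathfrak g$, and let $\iota:G_0\to G$ be the homomorphism of Lie groups whose differential is the inclusion $\mathfrak g_0\subset\mathfrak g$; $G_0$ acts on the complex dual space $\mathfrak g^*$ through $\iota$ and the coadjoint action of $G$. Let $c$ be the holomorphic linear Poisson bivector of $\mathfrak g^*$, $c_z(X,Y)=z([X,Y])$ for $X,Y\in\mathfrak g=(\mathfrak g^*)^*$, let $c_z^\sharp X=c_z(X,\cdot)$, and let $\operatorname{Sing}\mathfrak g^*$ be the union of the symplectic leaves of $c$ of nonmaximal dimension, i.e. the set of points $z$ at which the rank of $c_z^\sharp$ is not maximal. (1) Let $z_0\in\mathfrak g^*\setminus\operatorname{Sing}\mathfrak g^*$. The $G$-orbit $M=G(z_0)$ is an immersed complex submanifold of $\mathfrak g^*$ and the $G_0$-orbit $\mathcal O$ of $z_0$ is an immersed real $C^\infty$-submanifold of $\mathfrak g^*$ (both with the manifold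 structure of a homogeneous space). We have $T_xM=\operatorname{im}c_x^\sharp$ for $x\in M$, so that $M$ carries the holomorphic symplectic form $\omega=(c|_M)^{-1}$, that is, $\omega_x(c_x^\sharp X,c_x^\sharp Y)=x([X,Y])$. With respect to $\omega$, $\mathcal O$ is a $CR$-isotropic submanifold of $M$: the inclusion $\mathcal O\to M$ is a $C^\infty$ injective immersion, the dimension of $T^{1,0}_x\mathcal O=(T_x\mathcal O\otimes_{\mathbb R}\mathbb C)\cap T^{1,0}_xM$ does not depend on $x\in\mathcal O$, and $T_x^{1,0}\mathcal O\subset (T_x^{1,0}\mathcal O)^{\perp\omega(x)}$ for all $x\in\mathcal O$, where $\perp\omega(x)$ denotes the skew-orthogonal complement in $T_x^{1,0}M$. (2) Let $U\subset\mathfrak g^*$ be open and let $g$ be a holomorphic Casimir function of $c$ on $U$ (i.e. $c(g)=0$). Put $\tilde g(z)=\sum_i\overline{\frac{\partial g}{\partial z_i}(z)}\,z_i$, where $z_i$ are the linear coordinates on $\mathfrak g^*$ given by a basis of $\mathfrak g_0$. Then $\tilde g$ is $G_0$-invariant on $U$: for $z\in U$, $\tilde g(z\cdot h)=\tilde g(z)$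 for every $h$ in the connected component of $1$ in $\{h\in G_0: z\cdot h\in U\}$ (for every $h\in G_0$ if $U$ is $G_0$-invariant). -/

import Mathlib

open scoped Manifold ContDiff TensorProduct

universe u

noncomputable section

namespace CoadjointCR

/-! ### Immersed submanifolds of a vector space, and orbits -/

/-- An immersed `C^∞` submanifold (over `𝕜 = ℝ` or `ℂ`, a complex one being holomorphic) of a
finite-dimensional vector space `V`: a manifold `Carrier`, modelled on the finite-dimensional space
`Model`, with an injective immersion `incl` into `V`. (It is Hausdorff, since `incl` is continuous
and injective.) -/
structure ImmersedSubmanifold (𝕜 : Type) [RCLike 𝕜] (V : Type u) [NormedAddCommGroup V]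
    [NormedSpace 𝕜 V] where
  /-- the model vector space -/
  Model : Type
  [normed : NormedAddCommGroup Model]
  [space : NormedSpace 𝕜 Model]
  [finiteDim : FiniteDimensional 𝕜 Model]
  /-- the points -/
  Carrier : Type u
  [top : TopologicalSpace Carrier]
  [charts : ChartedSpace Model Carrier]
  [manifold : IsManifold 𝓘(𝕜, Model) ∞ Carrier]
  /-- the inclusion -/
  incl : Carrier → V
  incl_injective : Function.Injective incl
  incl_contMDiff : ContMDiff 𝓘(𝕜, Model) 𝓘(𝕜, V) ∞ incl
  incl_immersion : ∀ x, Function.Injective (mfderiv 𝓘(𝕜, Model) 𝓘(𝕜, V) incl x)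

attribute [instance] ImmersedSubmanifold.normed ImmersedSubmanifold.space
  ImmersedSubmanifold.finiteDim ImmersedSubmanifold.top ImmersedSubmanifold.charts
  ImmersedSubmanifold.manifold

/-- Let `f : H → V` be an orbit map `h ↦ z₀ · h` of a Lie group `H`. The immersed submanifold `S`
*is the orbit*, with the manifold structure of the homogeneous space, if the orbit map factors as a
surjective submersion `H → S` followed by the inclusion of `S`. In particular the image of `S` in
`V` is the orbit. This determines `S` uniquely up to a unique diffeomorphism over `V`. -/
def ImmersedSubmanifold.IsOrbit {𝕜 : Type} [RCLike 𝕜] {V : Type u} [NormedAddCommGroup V]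
    [NormedSpace 𝕜 V] (S : ImmersedSubmanifold 𝕜 V)
    (E : Type*) [NormedAddCommGroup E] [NormedSpace 𝕜 E]
    {H : Type*} [TopologicalSpace H] [ChartedSpace E H] (f : H → V) : Prop :=
  ∃ p : H → S.Carrier, Function.Surjective p ∧
    ContMDiff 𝓘(𝕜, E) 𝓘(𝕜, S.Model) ∞ p ∧
    (∀ h, Function.Surjective (mfderiv 𝓘(𝕜, E) 𝓘(𝕜, S.Model) p h)) ∧
    ∀ h, S.incl (p h) = f h

/-- The tangent space of an immersed submanifold of `V`, as a subspace of `V`. -/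
def ImmersedSubmanifold.tangentSpace {𝕜 : Type} [RCLike 𝕜] {V : Type u} [NormedAddCommGroup V]
    [NormedSpace 𝕜 V] (S : ImmersedSubmanifold 𝕜 V) (x : S.Carrier) : Submodule 𝕜 V :=
  let d : S.Model →L[𝕜] V := mfderiv 𝓘(𝕜, S.Model) 𝓘(𝕜, V) S.incl x
  LinearMap.range d.toLinearMap

/-! ### CR-geometry -/

section CR

variable (W : Type*) [AddCommGroup W] [Module ℂ W]

/-- The complex structure `𝒥` of a complex vector space `W`, as a real linear map. -/
def complexStructure : W →ₗ[ℝ] W where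
  toFun w := Complex.I • w
  map_add' := smul_add _
  map_smul' _ _ := smul_comm _ _ _

/-- `W^{1,0}`: the `i`-eigenspace of the complex structure in the complexification `ℂ ⊗_ℝ W`. -/
def oneZero : Submodule ℂ (ℂ ⊗[ℝ] W) :=
  Module.End.eigenspace ((complexStructure W).baseChange ℂ) Complex.I

variable {W}

/-- `T^{1,0} = T^ℂ ∩ W^{1,0}` for a real subspace `T` of the complex vector space `W`. -/
def oneZeroPart (T : Submodule ℝ W) : Submodule ℂ (ℂ ⊗[ℝ] W) :=
  T.baseChange ℂ ⊓ oneZero W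

/-- The `(2,0)`-form on `ℂ ⊗_ℝ W` given by a complex bilinear form on `W`: the complex bilinear
extension, whose value on `(a ⊗ v, b ⊗ w)` is `a b Ω(v, w) = Ω(a v, b w)`. -/
def twoZeroForm (Ω : W →ₗ[ℂ] W →ₗ[ℂ] ℂ) : (ℂ ⊗[ℝ] W) →ₗ[ℂ] (ℂ ⊗[ℝ] W) →ₗ[ℂ] ℂ :=
  Ω.compl₁₂ (LinearMap.liftBaseChange ℂ (LinearMap.id : W →ₗ[ℝ] W))
    (LinearMap.liftBaseChange ℂ (LinearMap.id : W →ₗ[ℝ] W))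

/-- The skew-orthogonal complement, inside `W^{1,0}`, of a subspace `A`. -/
def skewOrthogonal (Ω : W →ₗ[ℂ] W →ₗ[ℂ] ℂ) (A : Submodule ℂ (ℂ ⊗[ℝ] W)) :
    Submodule ℂ (ℂ ⊗[ℝ] W) where
  carrier := {u | u ∈ oneZero W ∧ ∀ v ∈ A, twoZeroForm Ω u v = 0}
  zero_mem' := ⟨zero_mem _, fun v _ => by simp⟩
  add_mem' ha hb := ⟨add_mem ha.1 hb.1, fun v hv => by simp [ha.2 v hv, hb.2 v hv]⟩
  smul_mem' c _ ha := ⟨Submodule.smul_mem _ c ha.1, fun v hv => by simp [ha.2 v hv]⟩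

end CR

section CRManifold

variable {EM : Type*} [NormedAddCommGroup EM] [NormedSpace ℂ EM]
  {M : Type*} [TopologicalSpace M] [ChartedSpace EM M]
  {EL : Type*} [NormedAddCommGroup EL] [NormedSpace ℝ EL]
  {L : Type*} [TopologicalSpace L] [ChartedSpace EL L]

/-- The tangent space `T_y L`, as a real subspace of the tangent space `EM` of the complex manifold
`M` at `j y`, for a map `j : L → M`. -/
def realTangent (j : L → M) (y : L) : Submodule ℝ EM :=
  let d : EL →L[ℝ] EM := mfderiv 𝓘(ℝ, EL) 𝓘(ℝ, EM) j y
  LinearMap.range d.toLinearMap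

/-- `T_y^{1,0} L ⊆ ℂ ⊗_ℝ T_{j y} M`. -/
def tangentOneZero (j : L → M) (y : L) : Submodule ℂ (ℂ ⊗[ℝ] EM) :=
  oneZeroPart (realTangent (EM := EM) (EL := EL) j y)

variable (EM EL) in
/-- `j : L → M` is a (`C^∞`, immersed) CR-submanifold of the complex manifold `M`: it is an
injective immersion and the dimension of `T^{1,0} L` is constant along `L`. -/
structure IsCRSubmanifold (j : L → M) : Prop where
  injective : Function.Injective j
  contMDiff : ContMDiff 𝓘(ℝ, EL) 𝓘(ℝ, EM) ∞ j
  immersion : ∀ y, Function.Injective (mfderiv 𝓘(ℝ, EL) 𝓘(ℝ, EM) j y)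
  finrank_const : ∃ d : ℕ, ∀ y,
    Module.finrank ℂ (tangentOneZero (EM := EM) (EL := EL) j y) = d

variable (EM EL) in
/-- `j : L → M` is a CR-isotropic submanifold with respect to the field `Ω` of complex bilinear
forms on the tangent spaces of `M`. -/
structure IsCRIsotropic (Ω : M → EM →ₗ[ℂ] EM →ₗ[ℂ] ℂ) (j : L → M) : Prop
    extends IsCRSubmanifold EM EL j where
  isotropic : ∀ y, tangentOneZero (EM := EM) (EL := EL) j y ≤
    skewOrthogonal (Ω (j y)) (tangentOneZero (EM := EM) (EL := EL) j y)

end CRManifold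

/-! ### The complex Lie group `G`, its coadjoint action and the linear Poisson structure of `𝔤*`

The Lie algebra `𝔤 = T_1 G` is by definition the model space `E` of `G`, and `𝔤*` is
`E →L[ℂ] ℂ`. -/

section Coadjoint

variable {E : Type u} [NormedAddCommGroup E] [NormedSpace ℂ E] [FiniteDimensional ℂ E]
  {G : Type*} [TopologicalSpace G] [ChartedSpace E G] [Group G]

/-- `Ad g : 𝔤 → 𝔤`, the differential of the conjugation by `g` at the identity. -/
def Ad (g : G) : E →L[ℂ] E :=
  mfderiv 𝓘(ℂ, E) 𝓘(ℂ, E) (fun x : G => g * x * g⁻¹) 1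

/-- The (right) coadjoint action `z · g = Ad*(g) z = z ∘ Ad g` on `𝔤*`. -/
def coadj (g : G) (z : E →L[ℂ] ℂ) : E →L[ℂ] ℂ := z.comp (Ad g)

variable [LieGroup 𝓘(ℂ, E) ∞ G]

variable (E G) in
/-- The Lie bracket of `𝔤`, as a bilinear map. -/
def bracket : E →ₗ[ℂ] E →ₗ[ℂ] E :=
  haveI : CompleteSpace E := FiniteDimensional.complete ℂ E
  haveI : LieGroup 𝓘(ℂ, E) (minSmoothness ℂ 3) G :=
    LieGroup.of_le (n := ∞) (by
      rw [minSmoothness_of_isRCLikeNormedField]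
      exact WithTop.coe_le_coe.2 (le_top : (3 : ℕ∞) ≤ ⊤))
  LinearMap.mk₂ ℂ
    (fun X Y => (⁅(show GroupLieAlgebra 𝓘(ℂ, E) G from X),
      (show GroupLieAlgebra 𝓘(ℂ, E) G from Y)⁆ : GroupLieAlgebra 𝓘(ℂ, E) G))
    (fun X X' Y => add_lie (L := GroupLieAlgebra 𝓘(ℂ, E) G)
      (M := GroupLieAlgebra 𝓘(ℂ, E) G) X X' Y)
    (fun c X Y => smul_lie (R := ℂ) (L := GroupLieAlgebra 𝓘(ℂ, E) G)
      (M := GroupLieAlgebra 𝓘(ℂ, E) G) c X Y)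
    (fun X Y Y' => lie_add (L := GroupLieAlgebra 𝓘(ℂ, E) G)
      (M := GroupLieAlgebra 𝓘(ℂ, E) G) X Y Y')
    (fun c X Y => lie_smul (R := ℂ) (L := GroupLieAlgebra 𝓘(ℂ, E) G)
      (M := GroupLieAlgebra 𝓘(ℂ, E) G) c X Y)

variable (G) in
/-- The linear Poisson bivector `c` of `𝔤*` at `z`, as a bilinear form on the cotangent space
`(𝔤*)* = 𝔤`: `c_z(X, Y) = z([X, Y])`. -/
def poisson (z : E →L[ℂ] ℂ) : E →ₗ[ℂ] E →ₗ[ℂ] ℂ :=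
  (bracket E G).compr₂ (z : E →ₗ[ℂ] ℂ)

variable (G) in
/-- The map `c_z^♯ : 𝔤 = T_z^*(𝔤*) → T_z(𝔤*) = 𝔤*`, `X ↦ c_z(X, ·)`. -/
def sharp (z : E →L[ℂ] ℂ) : E →ₗ[ℂ] (E →L[ℂ] ℂ) :=
  (LinearMap.toContinuousLinearMap : (E →ₗ[ℂ] ℂ) ≃ₗ[ℂ] (E →L[ℂ] ℂ)).toLinearMap ∘ₗ poisson G z

@[simp] theorem sharp_apply (z : E →L[ℂ] ℂ) (X Y : E) : sharp G z X Y = z (bracket E G X Y) := rfl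

variable (G) in
/-- The characteristic subspace `P_{c,z}` of the bivector `c`, i.e. the tangent space of the
symplectic leaf through `z`. -/
def charSubspace (z : E →L[ℂ] ℂ) : Submodule ℂ (E →L[ℂ] ℂ) := LinearMap.range (sharp G z)

variable (E G) in
/-- `Sing 𝔤*`: the union of the symplectic leaves of nonmaximal dimension of `c`; the dimension of
the leaf through `z` is the rank of `c` at `z`. -/
def Sing : Set (E →L[ℂ] ℂ) :=
  {z | ∃ w : E →L[ℂ] ℂ,
    Module.finrank ℂ (charSubspace G z) < Module.finrank ℂ (charSubspace G w)}

theorem exists_section {A B : Type*} [AddCommGroup A] [Module ℂ A] [AddCommGroup B] [Module ℂ B]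
    (f : A →ₗ[ℂ] B) : ∃ s : B →ₗ[ℂ] A, ∀ a, f (s (f a)) = f a := by
  obtain ⟨s, hs⟩ := f.rangeRestrict.exists_rightInverse_of_surjective f.range_rangeRestrict
  obtain ⟨t, ht⟩ := LinearMap.exists_extend s
  refine ⟨t, fun a => ?_⟩
  have h1 : t (f a) = s (f.rangeRestrict a) := by rw [← ht]; rfl
  rw [h1]
  exact congrArg Subtype.val (LinearMap.congr_fun hs (f.rangeRestrict a))

variable (G) in
theorem exists_sharpSection (z : E →L[ℂ] ℂ) :
    ∃ s : (E →L[ℂ] ℂ) →ₗ[ℂ] E, ∀ X, sharp G z (s (sharp G z X)) = sharp G z X :=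
  exists_section _

variable (G) in
/-- The form `ω_z = (c_z)⁻¹` on the characteristic subspace `P_{c,z}`:
`ω_z(c_z^♯ X, c_z^♯ Y) = c_z(X, Y)`, see `leafForm_sharp`. For convenience it is written as a
bilinear form on all of `𝔤*`, through a linear choice of preimages under `c_z^♯`; only its values
on `P_{c,z}`, which do not depend on the choice, are of interest. -/
def leafForm (z : E →L[ℂ] ℂ) : (E →L[ℂ] ℂ) →ₗ[ℂ] (E →L[ℂ] ℂ) →ₗ[ℂ] ℂ :=
  (poisson G z).compl₁₂ (exists_sharpSection G z).choose (exists_sharpSection G z).choose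

theorem bracket_skew (X Y : E) : bracket E G X Y = -bracket E G Y X := by
  have : CompleteSpace E := FiniteDimensional.complete ℂ E
  have : LieGroup 𝓘(ℂ, E) (minSmoothness ℂ 3) G :=
    LieGroup.of_le (n := ∞) (by
      rw [minSmoothness_of_isRCLikeNormedField]
      exact WithTop.coe_le_coe.2 (le_top : (3 : ℕ∞) ≤ ⊤))
  exact (lie_skew (L := GroupLieAlgebra 𝓘(ℂ, E) G) X Y).symm

theorem leafForm_sharp (z : E →L[ℂ] ℂ) (X Y : E) :
    leafForm G z (sharp G z X) (sharp G z Y) = poisson G z X Y := by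
  have hs := (exists_sharpSection G z).choose_spec
  set s := (exists_sharpSection G z).choose with hsdef
  have h1 : ∀ X Y, poisson G z X Y = sharp G z X Y := fun _ _ => rfl
  have h2 : ∀ X Y, sharp G z X Y = -sharp G z Y X := fun X Y => by
    rw [sharp_apply, sharp_apply, bracket_skew, map_neg]
  change poisson G z (s (sharp G z X)) (s (sharp G z Y)) = _
  rw [h1, hs, h2, hs, ← h2, h1]

variable (G) in
/-- The holomorphic symplectic form `ω = (c|_M)⁻¹` on a complex submanifold `M` of `𝔤*` whose
tangent spaces are the characteristic subspaces of `c`. -/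
def symplecticForm (M : ImmersedSubmanifold ℂ (E →L[ℂ] ℂ)) (x : M.Carrier) :
    M.Model →ₗ[ℂ] M.Model →ₗ[ℂ] ℂ :=
  let d : M.Model →L[ℂ] (E →L[ℂ] ℂ) := mfderiv 𝓘(ℂ, M.Model) 𝓘(ℂ, E →L[ℂ] ℂ) M.incl x
  (leafForm G (M.incl x)).compl₁₂ d.toLinearMap d.toLinearMap

variable (G) in
/-- Holomorphic Casimir functions of `c` over `U`: `c(g) = 0`, i.e.
`c_z(Y, dg_z) = dg_z(c_z^♯ Y) = 0` for all covectors `Y`. -/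
structure IsHolomorphicCasimir (U : Set (E →L[ℂ] ℂ)) (g : (E →L[ℂ] ℂ) → ℂ) : Prop where
  holomorphic : DifferentiableOn ℂ g U
  casimir : ∀ z ∈ U, ∀ Y, fderiv ℂ g z (sharp G z Y) = 0

end Coadjoint

/-! ### The real group `G₀` -/

section RealForm

variable {E₀ : Type*} [NormedAddCommGroup E₀] [NormedSpace ℝ E₀]
  {G₀ : Type*} [TopologicalSpace G₀] [ChartedSpace E₀ G₀] [Group G₀]
  {E : Type u} [NormedAddCommGroup E] [NormedSpace ℂ E]
  {G : Type*} [TopologicalSpace G] [ChartedSpace E G] [Group G]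

variable (E₀ E) in
/-- The differential `𝔤₀ → 𝔤` of `ι : G₀ → G` at the identity. -/
def differentialAtOne (ι : G₀ →* G) : E₀ →L[ℝ] E :=
  mfderiv 𝓘(ℝ, E₀) 𝓘(ℝ, E) ι 1

variable (E₀ E) in
/-- `ι : G₀ → G` is a homomorphism of Lie groups that makes the Lie algebra `𝔤` of `G` the
complexification of the Lie algebra `𝔤₀` of `G₀`: every element of `𝔤` is `X + i Y` for unique
`X, Y` in (the image of) `𝔤₀`. -/
structure IsComplexification (ι : G₀ →* G) : Prop where
  contMDiff : ContMDiff 𝓘(ℝ, E₀) 𝓘(ℝ, E) ∞ ι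
  bijective : Function.Bijective (fun p : E₀ × E₀ =>
    differentialAtOne E₀ E ι p.1 + Complex.I • differentialAtOne E₀ E ι p.2)

variable {ι : G₀ →* G}

/-- The real linear isomorphism `𝔤₀ × 𝔤₀ → 𝔤`, `(X, Y) ↦ X + i Y`. -/
def IsComplexification.equiv (hι : IsComplexification E₀ E ι) : (E₀ × E₀) ≃ₗ[ℝ] E :=
  LinearEquiv.ofBijective
    { toFun := fun p : E₀ × E₀ =>
        differentialAtOne E₀ E ι p.1 + Complex.I • differentialAtOne E₀ E ι p.2
      map_add' := fun p q => by
        simp only [Prod.fst_add, Prod.snd_add, map_add, smul_add]; abel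
      map_smul' := fun r p => by
        simp only [Prod.smul_fst, Prod.smul_snd, map_smul, smul_add, RingHom.id_apply,
          smul_comm Complex.I r] } hι.bijective

theorem IsComplexification.equiv_apply (hι : IsComplexification E₀ E ι) (X Y : E₀) :
    hι.equiv (X, Y) = differentialAtOne E₀ E ι X + Complex.I • differentialAtOne E₀ E ι Y := rfl

/-- The complex conjugation `X + i Y ↦ X - i Y` of `𝔤` with respect to `𝔤₀`. -/
def IsComplexification.conj (hι : IsComplexification E₀ E ι) (Z : E) : E :=
  hι.equiv ((hι.equiv.symm Z).1, -(hι.equiv.symm Z).2)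

theorem IsComplexification.conj_add (hι : IsComplexification E₀ E ι) (Z Z' : E) :
    hι.conj (Z + Z') = hι.conj Z + hι.conj Z' := by
  rw [conj, conj, conj, ← map_add, map_add]
  congr 1
  ext
  · rfl
  · simp [add_comm]

theorem IsComplexification.conj_smul (hι : IsComplexification E₀ E ι) (a : ℂ) (Z : E) :
    hι.conj (a • Z) = (starRingEnd ℂ a) • hι.conj Z := by
  obtain ⟨⟨X, Y⟩, rfl⟩ := hι.equiv.surjective Z
  have key : ∀ (b : ℂ) (X Y : E₀),
      b • hι.equiv (X, Y) = hι.equiv (b.re • X - b.im • Y, b.re • Y + b.im • X) := by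
    intro b X Y
    simp only [equiv_apply, map_sub, map_add, map_smul]
    simp only [← Complex.coe_smul]
    have h1 : b = b.re + b.im * Complex.I := (Complex.re_add_im b).symm
    have h2 : Complex.I * Complex.I = -1 := Complex.I_mul_I
    match_scalars
    · linear_combination h1
    · linear_combination Complex.I * h1 + (b.im : ℂ) * h2
  have hc : ∀ X Y : E₀, hι.conj (hι.equiv (X, Y)) = hι.equiv (X, -Y) := fun X Y => by
    simp [conj]
  rw [key, hc, hc, key]
  congr 1
  ext
  · simp
  · simp [add_comm]

/-- The conjugation of `𝔤*`: `z̄(Z) = conj (z (conj Z))`. -/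
def IsComplexification.conjDual [FiniteDimensional ℂ E] (hι : IsComplexification E₀ E ι)
    (z : E →L[ℂ] ℂ) : E →L[ℂ] ℂ :=
  LinearMap.toContinuousLinearMap
    { toFun := fun Z => starRingEnd ℂ (z (hι.conj Z))
      map_add' := fun Z Z' => by simp [hι.conj_add]
      map_smul' := fun a Z => by simp [hι.conj_smul] }

/-- The function `g̃(z) = ∑ conj (∂g/∂z_i) z_i = conj (∑ (∂g/∂z_i) z̄_i) = conj (dg_z(z̄))`, in the
linear coordinates `z_i` of `𝔤*` given by a basis of `𝔤₀`. -/
def IsComplexification.tilde [FiniteDimensional ℂ E] (hι : IsComplexification E₀ E ι)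
    (g : (E →L[ℂ] ℂ) → ℂ) (z : E →L[ℂ] ℂ) : ℂ :=
  starRingEnd ℂ (fderiv ℂ g z (hι.conjDual z))

end RealForm

end CoadjointCR

end

/-!
The orbit map of a linear action of a Lie group has constant rank. Hence it factors, near `1`,
through a slice on which it is an immersion, and the translates of one slice are charts of the
orbit. The tangent space of the `G`-orbit at `z` is `im c_z^♯` and that of the `G₀`-orbit is
`c_z^♯ 𝔤₀`, since the derivative of `Ad` at `1` is the bracket.

A holomorphic tangent vector of the `G₀`-orbit at `z` is a `c_z^♯ X` with `X ∈ 𝔤₀` such that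
`c_z^♯ (i X) = c_z^♯ X'` for some `X' ∈ 𝔤₀`, that is, `Z = X' - i X` lies in the kernel of `c_z^♯`.
If the rank of `c^♯` is maximal at `z`, this kernel is abelian. For two elements `Z` and `W` of it,
expanding `z([Z - Z̄, W - W̄])` gives three terms that vanish because `c_z^♯ Z = c_z^♯ W = 0` and a
fourth, `z([Z̄, W̄])`, the value of `z` at the conjugate of `[Z, W] = 0`. As `Z - Z̄ = -2 i X`, this
is the isotropy.

A Casimir function `g` satisfies `g (z · h) = g z` for `h` near `1` and `z` near a given point, so
`dg(z) = dg(z · h) ∘ (· h)`. The action of `G₀` commutes with the conjugation of `𝔤*`, so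
`dg(z)(z̄)`, the complex conjugate of `g̃(z)`, is locally constant on the orbits of `G₀`.
-/

noncomputable section

namespace CoadjointCR

open Set Filter Topology Function

/-! ### Derivatives between manifolds modelled on vector spaces -/

section ModelDeriv

variable {𝕜 : Type*} [NontriviallyNormedField 𝕜]
  {E₁ M₁ E₂ M₂ E₃ M₃ : Type*}
  [NormedAddCommGroup E₁] [NormedSpace 𝕜 E₁] [TopologicalSpace M₁] [ChartedSpace E₁ M₁]
  [NormedAddCommGroup E₂] [NormedSpace 𝕜 E₂] [TopologicalSpace M₂] [ChartedSpace E₂ M₂]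
  [NormedAddCommGroup E₃] [NormedSpace 𝕜 E₃] [TopologicalSpace M₃] [ChartedSpace E₃ M₃]

variable (𝕜 E₁ E₂) in
/-- The derivative of a map between manifolds, typed as a map between the model spaces instead of
the tangent spaces, so that derivatives at different points can be compared. -/
def modelDeriv (f : M₁ → M₂) (x : M₁) : E₁ →L[𝕜] E₂ := mfderiv 𝓘(𝕜, E₁) 𝓘(𝕜, E₂) f x

theorem modelDeriv_comp {g : M₂ → M₃} {f : M₁ → M₂} (x : M₁)
    (hg : MDifferentiableAt 𝓘(𝕜, E₂) 𝓘(𝕜, E₃) g (f x))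
    (hf : MDifferentiableAt 𝓘(𝕜, E₁) 𝓘(𝕜, E₂) f x) :
    modelDeriv 𝕜 E₁ E₃ (fun y => g (f y)) x =
      (modelDeriv 𝕜 E₂ E₃ g (f x)).comp (modelDeriv 𝕜 E₁ E₂ f x) :=
  mfderiv_comp x hg hf

theorem modelDeriv_id (x : M₁) : modelDeriv 𝕜 E₁ E₁ (fun y => y) x = ContinuousLinearMap.id 𝕜 E₁ :=
  mfderiv_id

theorem modelDeriv_eq_fderiv (f : E₁ → E₂) (x : E₁) : modelDeriv 𝕜 E₁ E₂ f x = fderiv 𝕜 f x :=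
  mfderiv_eq_fderiv

theorem modelDeriv_clm_comp (L : E₂ →L[𝕜] E₃) {f : M₁ → E₂} {x : M₁}
    (hf : MDifferentiableAt 𝓘(𝕜, E₁) 𝓘(𝕜, E₂) f x) :
    modelDeriv 𝕜 E₁ E₃ (fun y => L (f y)) x = L.comp (modelDeriv 𝕜 E₁ E₂ f x) := by
  rw [modelDeriv_comp x L.differentiableAt.mdifferentiableAt hf, modelDeriv_eq_fderiv, L.fderiv]

theorem modelDeriv_eq_fderiv_chart {f : M₁ → M₂} {x : M₁}
    (hf : MDifferentiableAt 𝓘(𝕜, E₁) 𝓘(𝕜, E₂) f x) :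
    modelDeriv 𝕜 E₁ E₂ f x = fderiv 𝕜 (fun y => extChartAt 𝓘(𝕜, E₂) (f x)
      (f ((extChartAt 𝓘(𝕜, E₁) x).symm y))) (extChartAt 𝓘(𝕜, E₁) x x) := by
  have h : modelDeriv 𝕜 E₁ E₂ f x = fderivWithin 𝕜 (writtenInExtChartAt 𝓘(𝕜, E₁) 𝓘(𝕜, E₂) x f)
      (range 𝓘(𝕜, E₁)) (extChartAt 𝓘(𝕜, E₁) x x) := hf.mfderiv
  rw [h, modelWithCornersSelf_coe, range_id, fderivWithin_univ]
  rfl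

theorem modelDeriv_chartAt_comp {f : M₁ → M₂} {x : M₁}
    (hf : MDifferentiableAt 𝓘(𝕜, E₁) 𝓘(𝕜, E₂) f x)
    (hχf : MDifferentiableAt 𝓘(𝕜, E₁) 𝓘(𝕜, E₂) (fun y => chartAt E₂ (f x) (f y)) x) :
    modelDeriv 𝕜 E₁ E₂ (fun y => chartAt E₂ (f x) (f y)) x = modelDeriv 𝕜 E₁ E₂ f x := by
  rw [modelDeriv_eq_fderiv_chart hf, modelDeriv_eq_fderiv_chart hχf]
  rfl

theorem surjective_modelDeriv_of_rightInverse {f : M₁ → M₂} {g : M₂ → M₁}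
    (hf : MDifferentiable 𝓘(𝕜, E₁) 𝓘(𝕜, E₂) f) (hg : MDifferentiable 𝓘(𝕜, E₂) 𝓘(𝕜, E₁) g)
    (hfg : ∀ y, f (g y) = y) (y : M₂) : Surjective (modelDeriv 𝕜 E₁ E₂ f (g y)) := by
  have h := modelDeriv_comp y (hf (g y)) (hg y)
  rw [funext hfg, modelDeriv_id] at h
  exact fun v => ⟨_, (DFunLike.congr_fun h v).symm⟩

end ModelDeriv

section RestrictScalars

variable {E₁ M₁ E₂ M₂ : Type*}
  [NormedAddCommGroup E₁] [NormedSpace ℂ E₁] [TopologicalSpace M₁] [ChartedSpace E₁ M₁]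
  [NormedAddCommGroup E₂] [NormedSpace ℂ E₂] [TopologicalSpace M₂] [ChartedSpace E₂ M₂]
  {n : WithTop ℕ∞} {f : M₁ → M₂}

theorem contMDiff_real_of_complex (hf : ContMDiff 𝓘(ℂ, E₁) 𝓘(ℂ, E₂) n f) :
    ContMDiff 𝓘(ℝ, E₁) 𝓘(ℝ, E₂) n f := fun x =>
  contMDiffAt_iff.2 ⟨(contMDiffAt_iff.1 (hf x)).1,
    (contMDiffAt_iff.1 (hf x)).2.restrict_scalars ℝ⟩

theorem hasMFDerivAt_real_of_complex {x : M₁}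
    (hf : MDifferentiableAt 𝓘(ℂ, E₁) 𝓘(ℂ, E₂) f x) :
    HasMFDerivAt 𝓘(ℝ, E₁) 𝓘(ℝ, E₂) f x
      ((modelDeriv ℂ E₁ E₂ f x).restrictScalars ℝ : E₁ →L[ℝ] E₂) :=
  ⟨hf.hasMFDerivAt.1, HasFDerivWithinAt.restrictScalars ℝ hf.hasMFDerivAt.2⟩

theorem modelDeriv_real_of_complex {x : M₁} (hf : MDifferentiableAt 𝓘(ℂ, E₁) 𝓘(ℂ, E₂) f x) :
    modelDeriv ℝ E₁ E₂ f x = (modelDeriv ℂ E₁ E₂ f x).restrictScalars ℝ :=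
  (hasMFDerivAt_real_of_complex hf).mfderiv

end RestrictScalars

/-! ### Submersions -/

section Straightening

variable {𝕜 : Type*} [RCLike 𝕜]
  {E W : Type*} [NormedAddCommGroup E] [NormedSpace 𝕜 E] [CompleteSpace E]
  [NormedAddCommGroup W] [NormedSpace 𝕜 W] {n : WithTop ℕ∞}

theorem eventually_contDiffAt_symm (Ψ : OpenPartialHomeomorph E W) {a : E} (ha : a ∈ Ψ.source)
    (hΨ : ∀ᶠ x in 𝓝 a, ContDiffAt 𝕜 n Ψ x) (hn : n ≠ 0) (hinv : (fderiv 𝕜 Ψ a).IsInvertible) :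
    ∀ᶠ y in 𝓝 (Ψ a), ContDiffAt 𝕜 n Ψ.symm y := by
  have hcont : ContinuousAt (fderiv 𝕜 Ψ) a :=
    ((hΨ.self_of_nhds.of_le (ENat.one_le_iff_ne_zero_withTop.2 hn)).fderiv_right
      (m := 0) le_rfl).continuousAt
  obtain ⟨Ψ', hΨ'⟩ := hinv
  have hinvertible : ∀ᶠ x in 𝓝 a, (fderiv 𝕜 Ψ x).IsInvertible :=
    hcont.eventually (by rw [← hΨ']; exact ContinuousLinearEquiv.nhds Ψ')
  have hsymm : Tendsto Ψ.symm (𝓝 (Ψ a)) (𝓝 a) := by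
    simpa only [Ψ.left_inv ha] using (Ψ.continuousAt_symm (Ψ.map_source ha)).tendsto
  filter_upwards [Ψ.open_target.mem_nhds (Ψ.map_source ha), hsymm.eventually hΨ,
    hsymm.eventually hinvertible] with y hy hsmooth ⟨L, hL⟩
  exact Ψ.contDiffAt_symm hy (hL ▸ (hsmooth.differentiableAt hn).hasFDerivAt) hsmooth

variable [FiniteDimensional 𝕜 W]

theorem exists_straightening {F : E → W} {a : E} (hF : ∀ᶠ x in 𝓝 a, ContDiffAt 𝕜 n F x)
    (hn : n ≠ 0) (hs : Surjective (fderiv 𝕜 F a)) :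
    ∃ Ψ : OpenPartialHomeomorph E (W × (fderiv 𝕜 F a).ker), a ∈ Ψ.source ∧
      (∀ x, (Ψ x).1 = F x) ∧ ContDiffOn 𝕜 n Ψ.symm Ψ.target := by
  have : CompleteSpace W := FiniteDimensional.complete 𝕜 W
  have hker := (fderiv 𝕜 F a).ker_closedComplemented_of_finiteDimensional_range
  let φ := (hF.self_of_nhds.hasStrictFDerivAt hn).implicitFunctionDataOfComplemented F
    (fderiv 𝕜 F a) (LinearMap.range_eq_top.2 hs) hker
  let Ψ := φ.toOpenPartialHomeomorph
  have hΨ : ∀ᶠ x in 𝓝 a, ContDiffAt 𝕜 n Ψ x := by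
    filter_upwards [hF] with x hx
    have hright : ContDiffAt 𝕜 n (fun x => hker.choose (x - a)) x := by fun_prop
    exact hx.prodMk hright
  have ha : a ∈ Ψ.source := φ.pt_mem_toOpenPartialHomeomorph_source
  obtain ⟨t, ht, hopen, hat⟩ :=
    eventually_nhds_iff.1 (eventually_contDiffAt_symm Ψ ha hΨ hn φ.isInvertible_fderiv_prodFun)
  exact ⟨(Ψ.symm.restrOpen t hopen).symm, ⟨ha, hat⟩, fun x => rfl,
    fun y hy => (ht y hy.2).contDiffWithinAt⟩

end Straightening

section Submersion

variable {𝕜 : Type*} [RCLike 𝕜]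
  {E₁ M₁ E₂ M₂ E₃ M₃ : Type*}
  [NormedAddCommGroup E₁] [NormedSpace 𝕜 E₁] [CompleteSpace E₁]
  [TopologicalSpace M₁] [ChartedSpace E₁ M₁] [IsManifold 𝓘(𝕜, E₁) ∞ M₁]
  [NormedAddCommGroup E₂] [NormedSpace 𝕜 E₂] [FiniteDimensional 𝕜 E₂]
  [TopologicalSpace M₂] [ChartedSpace E₂ M₂]
  [NormedAddCommGroup E₃] [NormedSpace 𝕜 E₃] [TopologicalSpace M₃] [ChartedSpace E₃ M₃]

theorem exists_manifold_straightening {f : M₁ → E₂} {x : M₁}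
    (hf : ∀ᶠ y in 𝓝 x, ContMDiffAt 𝓘(𝕜, E₁) 𝓘(𝕜, E₂) ∞ f y)
    (hs : Surjective (modelDeriv 𝕜 E₁ E₂ f x)) :
    ∃ Ψ : OpenPartialHomeomorph M₁ (E₂ × (modelDeriv 𝕜 E₁ E₂ f x).ker), x ∈ Ψ.source ∧
      (∀ y ∈ Ψ.source, (Ψ y).1 = f y) ∧
      ContMDiffOn 𝓘(𝕜, E₂ × (modelDeriv 𝕜 E₁ E₂ f x).ker) 𝓘(𝕜, E₁) ∞ Ψ.symm Ψ.target := by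
  let φ := chartAt E₁ x
  have hφ : ContMDiffOn 𝓘(𝕜, E₁) 𝓘(𝕜, E₁) ∞ φ.symm φ.target := contMDiffOn_chart_symm
  have hx : φ.symm (φ x) = x := φ.left_inv (mem_chart_source E₁ x)
  have hφx : φ x ∈ φ.target := φ.map_source (mem_chart_source E₁ x)
  have hF : ∀ᶠ u in 𝓝 (φ x), ContDiffAt 𝕜 ∞ (fun u => f (φ.symm u)) u := by
    have hsymm : Tendsto φ.symm (𝓝 (φ x)) (𝓝 x) := by
      simpa only [hx] using (φ.continuousAt_symm hφx).tendsto
    filter_upwards [hsymm.eventually hf, φ.open_target.mem_nhds hφx] with u hu hut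
    exact (hu.comp u (hφ.contMDiffAt (φ.open_target.mem_nhds hut))).contDiffAt
  have hderiv : modelDeriv 𝕜 E₁ E₂ f x = fderiv 𝕜 (fun u => f (φ.symm u)) (φ x) :=
    modelDeriv_eq_fderiv_chart (hf.self_of_nhds.mdifferentiableAt (by simp))
  rw [hderiv] at hs ⊢
  obtain ⟨Ψ, hmem, hfst, hsmooth⟩ := exists_straightening hF (by simp) hs
  refine ⟨φ.trans Ψ, ⟨mem_chart_source E₁ x, hmem⟩, fun y hy => ?_, ?_⟩
  · exact (hfst (φ y)).trans (congrArg f (φ.left_inv hy.1))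
  · exact hφ.comp (hsmooth.contMDiffOn.mono fun y hy => hy.1) fun y hy => hy.2

theorem exists_localSection [IsManifold 𝓘(𝕜, E₂) ∞ M₂] {p : M₁ → M₂}
    (hp : ContMDiff 𝓘(𝕜, E₁) 𝓘(𝕜, E₂) ∞ p) (x : M₁) (hs : Surjective (modelDeriv 𝕜 E₁ E₂ p x)) :
    ∃ s : M₂ → M₁, ContMDiffAt 𝓘(𝕜, E₂) 𝓘(𝕜, E₁) ∞ s (p x) ∧ ∀ᶠ y in 𝓝 (p x), p (s y) = y := by
  let χ := chartAt E₂ (p x)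
  have hχ : ∀ y ∈ χ.source, ContMDiffAt 𝓘(𝕜, E₂) 𝓘(𝕜, E₂) ∞ χ y := fun y hy =>
    contMDiffOn_chart.contMDiffAt (χ.open_source.mem_nhds hy)
  have hpx : p x ∈ χ.source := mem_chart_source E₂ (p x)
  have hχp : ∀ᶠ y in 𝓝 x, ContMDiffAt 𝓘(𝕜, E₁) 𝓘(𝕜, E₂) ∞ (fun y => χ (p y)) y := by
    filter_upwards [hp.continuous.continuousAt.eventually (χ.open_source.mem_nhds hpx)] with y hy
    exact (hχ _ hy).comp y (hp y)
  rw [← modelDeriv_chartAt_comp (hp.mdifferentiable (by simp) x)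
    (hχp.self_of_nhds.mdifferentiableAt (by simp))] at hs
  obtain ⟨Ψ, hmem, hfst, hsmooth⟩ := exists_manifold_straightening hχp hs
  have hΨx : (χ (p x), (Ψ x).2) = Ψ x := Prod.ext (hfst x hmem).symm rfl
  let s : M₂ → M₁ := fun y => Ψ.symm (χ y, (Ψ x).2)
  have hpair : ContMDiffAt 𝓘(𝕜, E₂) 𝓘(𝕜, E₂ × _) ∞ (fun y => (χ y, (Ψ x).2)) (p x) :=
    (hχ _ hpx).prodMk_space contMDiffAt_const
  have htarget : Ψ.target ∈ 𝓝 (χ (p x), (Ψ x).2) := by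
    rw [hΨx]; exact Ψ.open_target.mem_nhds (Ψ.map_source hmem)
  have hs_smooth : ContMDiffAt 𝓘(𝕜, E₂) 𝓘(𝕜, E₁) ∞ s (p x) :=
    ContMDiffAt.comp (p x) (hsmooth.contMDiffAt htarget) hpair
  refine ⟨s, hs_smooth, ?_⟩
  have hps : Tendsto (fun y => p (s y)) (𝓝 (p x)) (𝓝 (p x)) := by
    have hsx : s (p x) = x := (congrArg Ψ.symm hΨx).trans (Ψ.left_inv hmem)
    simpa only [ContinuousAt, comp_def, hsx] using
      hp.continuous.continuousAt.comp hs_smooth.continuousAt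
  filter_upwards [hpair.continuousAt.eventually htarget, χ.open_source.mem_nhds hpx,
    hps.eventually (χ.open_source.mem_nhds hpx)] with y hy hyχ hpsχ
  refine χ.injOn hpsχ hyχ ?_
  rw [← hfst (s y) (Ψ.map_target hy), Ψ.right_inv hy]

theorem contMDiff_of_comp_submersion [IsManifold 𝓘(𝕜, E₂) ∞ M₂] {p : M₁ → M₂}
    (hp : ContMDiff 𝓘(𝕜, E₁) 𝓘(𝕜, E₂) ∞ p) (hsurj : Surjective p)
    (hs : ∀ x, Surjective (modelDeriv 𝕜 E₁ E₂ p x)) {j : M₂ → M₃}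
    (hj : ContMDiff 𝓘(𝕜, E₁) 𝓘(𝕜, E₃) ∞ (fun x => j (p x))) :
    ContMDiff 𝓘(𝕜, E₂) 𝓘(𝕜, E₃) ∞ j := by
  intro y
  obtain ⟨x, rfl⟩ := hsurj y
  obtain ⟨s, hsmooth, hsection⟩ := exists_localSection hp x (hs x)
  refine ((hj _).comp (p x) hsmooth).congr_of_eventuallyEq ?_
  filter_upwards [hsection] with y hy
  rw [comp_apply, hy]

end Submersion

/-! ### Maps of constant rank -/

section ConstantRank

variable {𝕜 : Type*} [RCLike 𝕜]
  {E M V W K : Type*} [NormedAddCommGroup E] [NormedSpace 𝕜 E]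
  [NormedAddCommGroup V] [NormedSpace 𝕜 V]
  [NormedAddCommGroup W] [NormedSpace 𝕜 W]
  [NormedAddCommGroup K] [NormedSpace 𝕜 K]

theorem eq_zero_of_comp_eq_zero_of_finrank_range_le {R A B C : Type*} [DivisionRing R]
    [AddCommGroup A] [Module R A] [AddCommGroup B] [Module R B] [AddCommGroup C] [Module R C]
    [FiniteDimensional R C] {f : A →ₗ[R] B} {g : B →ₗ[R] C} [FiniteDimensional R f.range]
    (hs : Surjective (g ∘ₗ f)) (hr : Module.finrank R f.range ≤ Module.finrank R C) {v : A}
    (hv : g (f v) = 0) : f v = 0 := by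
  have hsurj : Surjective (g.domRestrict f.range) := fun c => by
    obtain ⟨a, ha⟩ := hs c
    exact ⟨f.rangeRestrict a, ha⟩
  have hfinrank := le_antisymm hr (LinearMap.finrank_le_finrank_of_surjective hsurj)
  have hinj := (LinearMap.injective_iff_surjective_of_finrank_eq_finrank hfinrank).2 hsurj
  exact congrArg Subtype.val ((injective_iff_map_eq_zero _).1 hinj (f.rangeRestrict v) hv)

theorem eq_of_comp_eq_fst_of_finrank_le [FiniteDimensional 𝕜 V] [FiniteDimensional 𝕜 W]
    {g : W × K → V} {P : V →L[𝕜] W} {c : W × K} {δ : ℝ}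
    (hg : DifferentiableOn 𝕜 g (Metric.ball c δ))
    (hP : ∀ y ∈ Metric.ball c δ, P (g y) = y.1)
    (hr : ∀ y ∈ Metric.ball c δ, Module.finrank 𝕜 (fderiv 𝕜 g y).range ≤ Module.finrank 𝕜 W)
    {w : W} {k k' : K} (hk : (w, k) ∈ Metric.ball c δ) (hk' : (w, k') ∈ Metric.ball c δ) :
    g (w, k) = g (w, k') := by
  have hmem : ∀ κ, (w, κ) ∈ Metric.ball c δ ↔ w ∈ Metric.ball c.1 δ ∧ κ ∈ Metric.ball c.2 δ :=
    fun κ => by rw [← ball_prod_same, mem_prod]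
  have hderiv : ∀ κ ∈ Metric.ball c.2 δ, HasFDerivAt (fun κ => g (w, κ)) (0 : K →L[𝕜] V) κ := by
    intro κ hκ
    have hy : (w, κ) ∈ Metric.ball c δ := (hmem κ).2 ⟨((hmem k).1 hk).1, hκ⟩
    have hgy := (hg.differentiableAt (Metric.isOpen_ball.mem_nhds hy)).hasFDerivAt
    have hPg : P.comp (fderiv 𝕜 g (w, κ)) = ContinuousLinearMap.fst 𝕜 W K :=
      (P.hasFDerivAt.comp (w, κ) hgy).unique (hasFDerivAt_fst.congr_of_eventuallyEq <| by
        filter_upwards [Metric.isOpen_ball.mem_nhds hy] with y hy using hP y hy)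
    have hvert : (fderiv 𝕜 g (w, κ)).comp (ContinuousLinearMap.inr 𝕜 W K) = 0 := by
      ext v
      refine eq_zero_of_comp_eq_zero_of_finrank_range_le (g := P.toLinearMap)
        (fun w' => ⟨(w', 0), DFunLike.congr_fun hPg (w', 0)⟩) (hr _ hy)
        (DFunLike.congr_fun hPg (0, v))
    exact hvert ▸ hgy.comp κ (hasFDerivAt_prodMk_right w κ)
  let : NormedSpace ℝ K := NormedSpace.restrictScalars ℝ 𝕜 K
  let : NormedSpace ℝ V := NormedSpace.restrictScalars ℝ 𝕜 V
  exact (convex_ball c.2 δ).is_const_of_fderivWithin_eq_zero (𝕜 := 𝕜)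
    (fun κ hκ => (hderiv κ hκ).differentiableAt.differentiableWithinAt)
    (fun κ hκ => ((hderiv κ hκ).hasFDerivWithinAt).fderivWithin
      (Metric.isOpen_ball.uniqueDiffWithinAt hκ))
    ((hmem k).1 hk).2 ((hmem k').1 hk').2

theorem exists_clm_comp_surjective {A : Type*} [AddCommGroup A] [Module 𝕜 A]
    [FiniteDimensional 𝕜 V] [FiniteDimensional 𝕜 W] (f : A →ₗ[𝕜] V)
    (hW : Module.finrank 𝕜 f.range = Module.finrank 𝕜 W) :
    ∃ P : V →L[𝕜] W, Surjective fun a => P (f a) := by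
  obtain ⟨p, hp⟩ := f.range.subtype.exists_leftInverse_of_injective f.range.ker_subtype
  let b : f.range ≃ₗ[𝕜] W := LinearEquiv.ofFinrankEq _ _ hW
  refine ⟨LinearMap.toContinuousLinearMap (b.toLinearMap ∘ₗ p), fun w => ?_⟩
  obtain ⟨a, ha⟩ := f.surjective_rangeRestrict (b.symm w)
  refine ⟨a, b.eq_symm_apply.1 ?_⟩
  rw [← ha]
  exact LinearMap.congr_fun hp (f.rangeRestrict a)

variable [TopologicalSpace M] [ChartedSpace E M]

theorem eventually_eq_comp_straightening [FiniteDimensional 𝕜 V] [FiniteDimensional 𝕜 W]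
    {f : M → V} (hf : MDifferentiable 𝓘(𝕜, E) 𝓘(𝕜, V) f) {x : M} {P : V →L[𝕜] W}
    {Ψ : OpenPartialHomeomorph M (W × K)} (hx : x ∈ Ψ.source)
    (hfst : ∀ y ∈ Ψ.source, (Ψ y).1 = P (f y))
    (hΨ : MDifferentiableOn 𝓘(𝕜, W × K) 𝓘(𝕜, E) Ψ.symm Ψ.target)
    (hr : ∀ᶠ y in 𝓝 x, Module.finrank 𝕜 (modelDeriv 𝕜 E V f y).range ≤ Module.finrank 𝕜 W) :
    ∀ᶠ y in 𝓝 x, f (Ψ.symm (P (f y), (Ψ x).2)) = f y := by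
  have htarget : ∀ᶠ y in 𝓝 (Ψ x), y ∈ Ψ.target := Ψ.open_target.mem_nhds (Ψ.map_source hx)
  obtain ⟨δ, hδ, hball⟩ :=
    Metric.eventually_nhds_iff_ball.1 (htarget.and ((Ψ.tendsto_symm hx).eventually hr))
  have hsymm : ∀ y ∈ Metric.ball (Ψ x) δ, MDifferentiableAt 𝓘(𝕜, W × K) 𝓘(𝕜, E) Ψ.symm y :=
    fun y hy => (hΨ y (hball y hy).1).mdifferentiableAt (Ψ.open_target.mem_nhds (hball y hy).1)
  have hg : DifferentiableOn 𝕜 (fun y => f (Ψ.symm y)) (Metric.ball (Ψ x) δ) := fun y hy =>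
    (mdifferentiableAt_iff_differentiableAt.1
      ((hf _).comp y (hsymm y hy))).differentiableWithinAt
  have hPfst : ∀ y ∈ Metric.ball (Ψ x) δ, P (f (Ψ.symm y)) = y.1 := fun y hy => by
    rw [← hfst _ (Ψ.map_target (hball y hy).1), Ψ.right_inv (hball y hy).1]
  have hrank : ∀ y ∈ Metric.ball (Ψ x) δ,
      Module.finrank 𝕜 (fderiv 𝕜 (fun y => f (Ψ.symm y)) y).range ≤ Module.finrank 𝕜 W := by
    intro y hy
    rw [← modelDeriv_eq_fderiv, modelDeriv_comp y (hf _) (hsymm y hy)]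
    exact (Submodule.finrank_mono (LinearMap.range_comp_le_range _ _)).trans (hball y hy).2
  filter_upwards [(Ψ.continuousAt hx).eventually (Metric.ball_mem_nhds _ hδ),
    Ψ.open_source.mem_nhds hx] with y hy hys
  have hΨy : (P (f y), (Ψ y).2) = Ψ y := Prod.ext (hfst y hys).symm rfl
  have hyx : (P (f y), (Ψ x).2) ∈ Metric.ball (Ψ x) δ := by
    rw [← hΨy, Prod.dist_eq] at hy
    rw [Metric.mem_ball, Prod.dist_eq, dist_self]
    exact max_lt ((le_max_left _ _).trans_lt hy) hδ
  have hconst := eq_of_comp_eq_fst_of_finrank_le hg hPfst hrank hyx (hΨy ▸ hy)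
  rwa [hΨy, Ψ.left_inv hys] at hconst

variable [CompleteSpace E] [IsManifold 𝓘(𝕜, E) ∞ M]

theorem exists_factorization_of_finrank_le [FiniteDimensional 𝕜 V] [FiniteDimensional 𝕜 W]
    {f : M → V} (hf : ContMDiff 𝓘(𝕜, E) 𝓘(𝕜, V) ∞ f) {x : M} {P : V →L[𝕜] W}
    (hP : Surjective (P.comp (modelDeriv 𝕜 E V f x)))
    (hr : ∀ᶠ y in 𝓝 x, Module.finrank 𝕜 (modelDeriv 𝕜 E V f y).range ≤ Module.finrank 𝕜 W) :
    ∃ σ : W → M, σ (P (f x)) = x ∧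
      (∀ᶠ w in 𝓝 (P (f x)), ContMDiffAt 𝓘(𝕜, W) 𝓘(𝕜, E) ∞ σ w ∧ P (f (σ w)) = w) ∧
      ∀ᶠ y in 𝓝 x, f (σ (P (f y))) = f y := by
  have hdf : MDifferentiable 𝓘(𝕜, E) 𝓘(𝕜, V) f := hf.mdifferentiable (by simp)
  have hPf : ContMDiff 𝓘(𝕜, E) 𝓘(𝕜, W) ∞ (fun y => P (f y)) := P.contMDiff.comp hf
  rw [← modelDeriv_clm_comp P (hdf x)] at hP
  obtain ⟨Ψ, hx, hfst, hsmooth⟩ := exists_manifold_straightening (.of_forall hPf) hP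
  have hΨx : (P (f x), (Ψ x).2) = Ψ x := Prod.ext (hfst x hx).symm rfl
  refine ⟨fun w => Ψ.symm (w, (Ψ x).2), (congrArg Ψ.symm hΨx).trans (Ψ.left_inv hx), ?_,
    eventually_eq_comp_straightening hdf hx hfst (hsmooth.mdifferentiableOn (by simp)) hr⟩
  have htarget : ∀ᶠ w in 𝓝 (P (f x)), (w, (Ψ x).2) ∈ Ψ.target :=
    (Continuous.prodMk_left (Ψ x).2).continuousAt.eventually
      (Ψ.open_target.mem_nhds (by simpa only [hΨx] using Ψ.map_source hx))
  filter_upwards [htarget] with w hw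
  refine ⟨?_, by rw [← hfst _ (Ψ.map_target hw), Ψ.right_inv hw]⟩
  exact (hsmooth.contMDiffAt (Ψ.open_target.mem_nhds hw)).comp w
    (contMDiffAt_id.prodMk_space contMDiffAt_const)

variable (W) in
/-- A slice of `f : M → V` through `x`, parametrized by the open subset `base` of `W`: on the
neighborhood `nhd` of `x`, the map `f` factors through the coordinates `coord ∘ f`, of which `param`
is a section. -/
structure LocalSlice (f : M → V) (x : M) where
  coord : V →L[𝕜] W
  base : Set W
  param : W → M
  nhd : Set M
  isOpen_base : IsOpen base
  isOpen_nhd : IsOpen nhd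
  mem_nhd : x ∈ nhd
  contMDiffOn_param : ContMDiffOn 𝓘(𝕜, W) 𝓘(𝕜, E) ∞ param base
  param_mem : ∀ w ∈ base, param w ∈ nhd
  coord_mem : ∀ y ∈ nhd, coord (f y) ∈ base
  coord_param : ∀ w ∈ base, coord (f (param w)) = w
  param_coord : ∀ y ∈ nhd, f (param (coord (f y))) = f y

theorem nonempty_localSlice [FiniteDimensional 𝕜 V] [FiniteDimensional 𝕜 W] {f : M → V}
    (hf : ContMDiff 𝓘(𝕜, E) 𝓘(𝕜, V) ∞ f) {x : M}
    (hx : Module.finrank 𝕜 (modelDeriv 𝕜 E V f x).range = Module.finrank 𝕜 W)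
    (hr : ∀ᶠ y in 𝓝 x, Module.finrank 𝕜 (modelDeriv 𝕜 E V f y).range ≤ Module.finrank 𝕜 W) :
    Nonempty (LocalSlice (𝕜 := 𝕜) (E := E) W f x) := by
  obtain ⟨P, hP⟩ := exists_clm_comp_surjective (modelDeriv 𝕜 E V f x).toLinearMap hx
  obtain ⟨σ, hσx, hσ, hfactor⟩ := exists_factorization_of_finrank_le hf hP hr
  obtain ⟨N, hN, hNopen, hxN⟩ := eventually_nhds_iff.1 hfactor
  have hσN : ∀ᶠ w in 𝓝 (P (f x)), σ w ∈ N :=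
    hσ.self_of_nhds.1.continuousAt.eventually (hσx.symm ▸ hNopen.mem_nhds hxN)
  obtain ⟨B, hB, hBopen, hxB⟩ := eventually_nhds_iff.1 (hσ.and hσN)
  exact ⟨{
    coord := P
    base := B
    param := σ
    nhd := N ∩ (fun y => P (f y)) ⁻¹' B
    isOpen_base := hBopen
    isOpen_nhd := hNopen.inter (hBopen.preimage (P.continuous.comp hf.continuous))
    mem_nhd := ⟨hxN, hxB⟩
    contMDiffOn_param := fun w hw => (hB w hw).1.1.contMDiffWithinAt
    param_mem := fun w hw => ⟨(hB w hw).2, mem_preimage.2 ((hB w hw).1.2.symm ▸ hw)⟩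
    coord_mem := fun y hy => hy.2
    coord_param := fun w hw => (hB w hw).1.2
    param_coord := fun y hy => hN y hy.1 }⟩

end ConstantRank

/-! ### Orbits of Lie groups as immersed submanifolds -/

section OrbitMap

variable {𝕜 : Type*} [RCLike 𝕜] {E : Type*} [NormedAddCommGroup E] [NormedSpace 𝕜 E]
  {H : Type*} [TopologicalSpace H] [ChartedSpace E H] [Group H]
  {V : Type*} [NormedAddCommGroup V] [NormedSpace 𝕜 V]

variable (E) in
/-- `f` is a smooth map from a Lie group to a vector space `V` that intertwines the right
multiplication with the linear automorphisms `A g` of `V`. It is the orbit map of `f 1` if `A` is a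
right action. -/
structure IsOrbitMap (A : H → V ≃L[𝕜] V) (f : H → V) : Prop where
  contMDiff : ContMDiff 𝓘(𝕜, E) 𝓘(𝕜, V) ∞ f
  map_mul : ∀ x g, f (x * g) = A g (f x)

variable [LieGroup 𝓘(𝕜, E) ∞ H]

theorem surjective_modelDeriv_mul_right (g x : H) :
    Surjective (modelDeriv 𝕜 E E (fun y => y * g) x) := by
  have h := surjective_modelDeriv_of_rightInverse (f := fun y : H => y * g)
    ((contMDiff_mul_right (I := 𝓘(𝕜, E)) (n := ∞)).mdifferentiable (by simp))
    ((contMDiff_mul_right (I := 𝓘(𝕜, E)) (n := ∞)).mdifferentiable (by simp))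
    (fun y => inv_mul_cancel_right y g) (x * g)
  rwa [mul_inv_cancel_right] at h

theorem surjective_modelDeriv_mul_left (g x : H) :
    Surjective (modelDeriv 𝕜 E E (fun y => g * y) x) := by
  have h := surjective_modelDeriv_of_rightInverse (f := fun y : H => g * y)
    ((contMDiff_mul_left (I := 𝓘(𝕜, E)) (n := ∞)).mdifferentiable (by simp))
    ((contMDiff_mul_left (I := 𝓘(𝕜, E)) (n := ∞)).mdifferentiable (by simp))
    (fun y => mul_inv_cancel_left g y) (g * x)
  rwa [inv_mul_cancel_left] at h

theorem range_modelDeriv_eq_range_modelDeriv_mul_left {f : H → V}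
    (hf : MDifferentiable 𝓘(𝕜, E) 𝓘(𝕜, V) f) (g : H) :
    (modelDeriv 𝕜 E V f g).range = (modelDeriv 𝕜 E V (fun x => f (g * x)) 1).range := by
  have hcomp : modelDeriv 𝕜 E V (fun x => f (g * x)) 1 =
      (modelDeriv 𝕜 E V f (g * 1)).comp (modelDeriv 𝕜 E E (fun y => g * y) 1) :=
    modelDeriv_comp 1 (hf _) ((contMDiff_mul_left (n := ∞)).mdifferentiable (by simp) _)
  rw [hcomp, mul_one, ContinuousLinearMap.toLinearMap_comp, LinearMap.range_comp_of_range_eq_top _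
    (LinearMap.range_eq_top.2 (surjective_modelDeriv_mul_left g 1))]

namespace IsOrbitMap

variable {A : H → V ≃L[𝕜] V} {f : H → V}

theorem range_modelDeriv (hf : IsOrbitMap E A f) (h : H) :
    (modelDeriv 𝕜 E V f h).range =
      (modelDeriv 𝕜 E V f 1).range.map (A h : V →L[𝕜] V).toLinearMap := by
  have hdf : MDifferentiable 𝓘(𝕜, E) 𝓘(𝕜, V) f := hf.contMDiff.mdifferentiable (by simp)
  have hcomp : modelDeriv 𝕜 E V (fun x => f (x * h)) 1 =
      (modelDeriv 𝕜 E V f (1 * h)).comp (modelDeriv 𝕜 E E (fun y => y * h) 1) :=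
    modelDeriv_comp 1 (hdf _) ((contMDiff_mul_right (n := ∞)).mdifferentiable (by simp) _)
  have hequiv : (fun x => f (x * h)) = fun x => (A h : V →L[𝕜] V) (f x) :=
    funext fun x => hf.map_mul x h
  rw [hequiv, modelDeriv_clm_comp _ (hdf 1), one_mul] at hcomp
  rw [← LinearMap.range_comp, ← ContinuousLinearMap.toLinearMap_comp, hcomp,
    ContinuousLinearMap.toLinearMap_comp, LinearMap.range_comp_of_range_eq_top _
      (LinearMap.range_eq_top.2 (surjective_modelDeriv_mul_right h 1))]

theorem finrank_range_modelDeriv (hf : IsOrbitMap E A f) (h : H) :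
    Module.finrank 𝕜 (modelDeriv 𝕜 E V f h).range =
      Module.finrank 𝕜 (modelDeriv 𝕜 E V f 1).range := by
  rw [hf.range_modelDeriv h]
  exact (A h).toLinearEquiv.finrank_map_eq _

end IsOrbitMap

end OrbitMap

section OrbitSpace

variable {H : Type*} {V : Type u}

/-- The image of an orbit map, to be given the topology of the homogeneous space instead of the
subspace topology. -/
def OrbitSpace (f : H → V) : Type u := range f

namespace OrbitSpace

/-- The orbit map as a map onto the orbit. -/
def proj (f : H → V) : H → OrbitSpace f := rangeFactorization f

/-- The inclusion of the orbit into the vector space. -/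
def incl (f : H → V) : OrbitSpace f → V := Subtype.val

theorem surjective_proj (f : H → V) : Surjective (proj f) := rangeFactorization_surjective

theorem incl_proj (f : H → V) (h : H) : incl f (proj f h) = f h := rfl

theorem incl_injective (f : H → V) : Injective (incl f) := Subtype.val_injective

instance [TopologicalSpace H] (f : H → V) : TopologicalSpace (OrbitSpace f) :=
  .coinduced (proj f) inferInstance

theorem continuous_proj [TopologicalSpace H] (f : H → V) : Continuous (proj f) :=
  continuous_coinduced_rng

end OrbitSpace

end OrbitSpace

namespace LocalSlice

variable {𝕜 : Type*} [RCLike 𝕜] {E : Type*} [NormedAddCommGroup E] [NormedSpace 𝕜 E]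
  {H : Type*} [TopologicalSpace H] [ChartedSpace E H] [Group H] [LieGroup 𝓘(𝕜, E) ∞ H]
  {V : Type u} [NormedAddCommGroup V] [NormedSpace 𝕜 V]
  {W : Type*} [NormedAddCommGroup W] [NormedSpace 𝕜 W]
  {A : H → V ≃L[𝕜] V} {f : H → V} (S : LocalSlice (𝕜 := 𝕜) (E := E) W f 1)
  (hf : IsOrbitMap E A f)

include hf in
theorem isOpen_setOf_param_coord :
    IsOpen {x : H | S.coord (f x) ∈ S.base ∧ f (S.param (S.coord (f x))) = f x} := by
  have : ContinuousMul H := continuousMul_of_contMDiffMul 𝓘(𝕜, E) ∞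
  rw [isOpen_iff_mem_nhds]
  rintro x ⟨hbase, hparam⟩
  set s := S.param (S.coord (f x))
  have hstab : f (x * s⁻¹) = f 1 := by
    rw [hf.map_mul, ← hparam, ← hf.map_mul, mul_inv_cancel]
  have hinv : ∀ y, f ((x * s⁻¹)⁻¹ * y) = f y := fun y => by
    rw [← mul_inv_cancel_left (x * s⁻¹) y, hf.map_mul (x * s⁻¹), hstab, ← hf.map_mul, one_mul,
      inv_mul_cancel_left]
  have hmem : (x * s⁻¹)⁻¹ * x ∈ S.nhd := by
    rw [show (x * s⁻¹)⁻¹ * x = s by group]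
    exact S.param_mem _ hbase
  filter_upwards [(S.isOpen_nhd.preimage (continuous_const_mul (x * s⁻¹)⁻¹)).mem_nhds hmem]
    with y hy
  have h := And.intro (S.coord_mem _ hy) (S.param_coord _ hy)
  rwa [hinv y] at h

/-- The chart of the orbit around `f g` given by the translate by `g` of a slice. -/
def chart (g : H) : OpenPartialHomeomorph (OrbitSpace f) W where
  toFun y := S.coord ((A g).symm (OrbitSpace.incl f y))
  invFun w := OrbitSpace.proj f (S.param w * g)
  source := {y | S.coord ((A g).symm (OrbitSpace.incl f y)) ∈ S.base ∧
    f (S.param (S.coord ((A g).symm (OrbitSpace.incl f y)))) =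
      (A g).symm (OrbitSpace.incl f y)}
  target := S.base
  map_source' y hy := hy.1
  map_target' w hw := by
    simp only [mem_ofPred_eq, OrbitSpace.incl_proj, hf.map_mul,
      ContinuousLinearEquiv.symm_apply_apply, S.coord_param w hw, hw, and_self]
  left_inv' y hy := OrbitSpace.incl_injective f (by
    rw [OrbitSpace.incl_proj, hf.map_mul, hy.2, ContinuousLinearEquiv.apply_symm_apply])
  right_inv' w hw := by
    simp only [OrbitSpace.incl_proj, hf.map_mul, ContinuousLinearEquiv.symm_apply_apply,
      S.coord_param w hw]
  open_source := by
    have : ContinuousMul H := continuousMul_of_contMDiffMul 𝓘(𝕜, E) ∞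
    have htranslate : ∀ x, (A g).symm (f x) = f (x * g⁻¹) := fun x => by
      rw [ContinuousLinearEquiv.symm_apply_eq, ← hf.map_mul, inv_mul_cancel_right]
    rw [isOpen_coinduced]
    simpa only [preimage_ofPred_eq, ← htranslate] using!
      (S.isOpen_setOf_param_coord hf).preimage (continuous_mul_const g⁻¹)
  open_target := S.isOpen_base
  continuousOn_toFun := by
    refine Continuous.continuousOn (continuous_coinduced_dom.2 ?_)
    exact S.coord.continuous.comp ((A g).symm.continuous.comp hf.contMDiff.continuous)
  continuousOn_invFun := by
    have : ContinuousMul H := continuousMul_of_contMDiffMul 𝓘(𝕜, E) ∞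
    exact (OrbitSpace.continuous_proj f).comp_continuousOn
      (S.contMDiffOn_param.continuousOn.mul continuousOn_const)

theorem proj_mem_chart_source (g : H) : OrbitSpace.proj f g ∈ (S.chart hf g).source := by
  have h1 : (A g).symm (f g) = f 1 := by
    rw [ContinuousLinearEquiv.symm_apply_eq, ← hf.map_mul, one_mul]
  change S.coord ((A g).symm (f g)) ∈ S.base ∧ f (S.param (S.coord ((A g).symm (f g)))) = _
  rw [OrbitSpace.incl_proj, h1]
  exact ⟨S.coord_mem 1 S.mem_nhd, S.param_coord 1 S.mem_nhd⟩

/-- The atlas of the orbit given by the translates of a slice. -/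
abbrev chartedSpace : ChartedSpace W (OrbitSpace f) where
  atlas := range (S.chart hf)
  chartAt y := S.chart hf (surjInv (OrbitSpace.surjective_proj f) y)
  mem_chart_source y := by
    have h := S.proj_mem_chart_source hf (surjInv (OrbitSpace.surjective_proj f) y)
    rwa [surjInv_eq (OrbitSpace.surjective_proj f)] at h
  chart_mem_atlas y := mem_range_self _

omit [LieGroup 𝓘(𝕜, E) ∞ H] in
include hf in
theorem contMDiff_coord (g : H) : ContMDiff 𝓘(𝕜, E) 𝓘(𝕜, W) ∞
    (fun x => S.coord ((A g).symm (f x))) :=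
  S.coord.contMDiff.comp ((A g).symm.contDiff.contMDiff.comp hf.contMDiff)

theorem contMDiffOn_param_mul (g : H) :
    ContMDiffOn 𝓘(𝕜, W) 𝓘(𝕜, E) ∞ (fun w => S.param w * g) S.base :=
  (contMDiff_mul_right (a := g)).comp_contMDiffOn S.contMDiffOn_param

theorem isManifold :
    letI := S.chartedSpace hf
    IsManifold 𝓘(𝕜, W) ∞ (OrbitSpace f) := by
  let := S.chartedSpace hf
  refine isManifold_of_contDiffOn _ _ _ ?_
  rintro _ _ ⟨g, rfl⟩ ⟨g', rfl⟩
  simp only [modelWithCornersSelf_coe, modelWithCornersSelf_coe_symm, Function.comp_id,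
    Function.id_comp, preimage_id, range_id, inter_univ]
  have hcoord := (S.contMDiff_coord hf g').comp_contMDiffOn (S.contMDiffOn_param_mul g)
  exact (contMDiffOn_iff_contDiffOn.1 hcoord).mono fun w hw => hw.1

theorem contMDiff_proj :
    letI := S.chartedSpace hf
    ContMDiff 𝓘(𝕜, E) 𝓘(𝕜, W) ∞ (OrbitSpace.proj f) := by
  let := S.chartedSpace hf
  have := S.isManifold hf
  exact contMDiff_iff_target.2 ⟨OrbitSpace.continuous_proj f, fun y =>
    (S.contMDiff_coord hf (surjInv (OrbitSpace.surjective_proj f) y)).contMDiffOn⟩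

theorem contMDiff_incl :
    letI := S.chartedSpace hf
    ContMDiff 𝓘(𝕜, W) 𝓘(𝕜, V) ∞ (OrbitSpace.incl f) := by
  let := S.chartedSpace hf
  have := S.isManifold hf
  intro y
  set g := surjInv (OrbitSpace.surjective_proj f) y
  have hy : y ∈ (S.chart hf g).source := mem_chart_source W y
  have hparam := (hf.contMDiff.comp_contMDiffOn (S.contMDiffOn_param_mul g)).contMDiffAt
    (S.isOpen_base.mem_nhds ((S.chart hf g).map_source hy))
  refine (hparam.comp y
    (contMDiffAt_extChartAt (I := 𝓘(𝕜, W)) (x := y))).congr_of_eventuallyEq ?_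
  filter_upwards [(S.chart hf g).open_source.mem_nhds hy] with z hz
  exact congrArg (OrbitSpace.incl f) ((S.chart hf g).left_inv hz).symm

end LocalSlice

theorem injective_and_surjective_of_finrank_range_comp {R K₁ K₂ K₃ : Type*} [DivisionRing R]
    [AddCommGroup K₁] [Module R K₁] [AddCommGroup K₂] [Module R K₂] [AddCommGroup K₃]
    [Module R K₃] [FiniteDimensional R K₂] {a : K₁ →ₗ[R] K₂} {b : K₂ →ₗ[R] K₃}
    (h : Module.finrank R (b ∘ₗ a).range = Module.finrank R K₂) :
    Injective b ∧ Surjective a := by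
  have hb : Module.finrank R (b ∘ₗ a).range ≤ Module.finrank R b.range :=
    Submodule.finrank_mono (LinearMap.range_comp_le_range a b)
  have ha : Module.finrank R (b ∘ₗ a).range ≤ Module.finrank R a.range := by
    rw [LinearMap.range_comp]
    exact Submodule.finrank_map_le b a.range
  constructor
  · have hrank := b.finrank_range_add_finrank_ker
    rw [← LinearMap.ker_eq_bot, ← Submodule.finrank_eq_zero (R := R)]
    omega
  · rw [← LinearMap.range_eq_top]
    exact Submodule.eq_top_of_finrank_eq (le_antisymm (Submodule.finrank_le _) (h ▸ ha))

theorem IsOrbitMap.exists_immersedSubmanifold {𝕜 : Type} [RCLike 𝕜] {E : Type*}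
    [NormedAddCommGroup E] [NormedSpace 𝕜 E] [CompleteSpace E] {H : Type*} [TopologicalSpace H]
    [ChartedSpace E H] [Group H] [LieGroup 𝓘(𝕜, E) ∞ H] {V : Type u} [NormedAddCommGroup V]
    [NormedSpace 𝕜 V] [FiniteDimensional 𝕜 V] {A : H → V ≃L[𝕜] V} {f : H → V}
    (hf : IsOrbitMap E A f) : ∃ M : ImmersedSubmanifold 𝕜 V, M.IsOrbit E f := by
  let W := Fin (Module.finrank 𝕜 (modelDeriv 𝕜 E V f 1).range) → 𝕜
  have hW : Module.finrank 𝕜 (modelDeriv 𝕜 E V f 1).range = Module.finrank 𝕜 W :=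
    (Module.finrank_fin_fun 𝕜).symm
  obtain ⟨S⟩ := nonempty_localSlice hf.contMDiff hW
    (.of_forall fun h => ((hf.finrank_range_modelDeriv h).trans hW).le)
  let := S.chartedSpace hf
  have := S.isManifold hf
  have hincl := S.contMDiff_incl hf
  have hproj := S.contMDiff_proj hf
  have hderiv : ∀ h : H, Injective (modelDeriv 𝕜 W V (OrbitSpace.incl f) (OrbitSpace.proj f h)) ∧
      Surjective (modelDeriv 𝕜 E W (OrbitSpace.proj f) h) := by
    intro h
    have hcomp : modelDeriv 𝕜 E V f h = (modelDeriv 𝕜 W V (OrbitSpace.incl f)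
        (OrbitSpace.proj f h)).comp (modelDeriv 𝕜 E W (OrbitSpace.proj f) h) :=
      modelDeriv_comp h (hincl.mdifferentiable (by simp) _) (hproj.mdifferentiable (by simp) _)
    have hrank := (hf.finrank_range_modelDeriv h).trans hW
    rw [hcomp, ContinuousLinearMap.toLinearMap_comp] at hrank
    exact injective_and_surjective_of_finrank_range_comp hrank
  refine ⟨⟨W, OrbitSpace f, OrbitSpace.incl f, OrbitSpace.incl_injective f, hincl, fun y => ?_⟩,
    OrbitSpace.proj f, OrbitSpace.surjective_proj f, hproj, fun h => (hderiv h).2, fun h => rfl⟩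
  obtain ⟨h, rfl⟩ := OrbitSpace.surjective_proj f y
  exact (hderiv h).1

/-! ### The adjoint and coadjoint representations -/

section Adjoint

variable {E : Type u} [NormedAddCommGroup E] [NormedSpace ℂ E]
  {G : Type*} [TopologicalSpace G] [ChartedSpace E G] [Group G]

theorem Ad_eq_modelDeriv (g : G) : Ad g = modelDeriv ℂ E E (fun x : G => g * x * g⁻¹) 1 := rfl

theorem Ad_one : Ad (E := E) (1 : G) = ContinuousLinearMap.id ℂ E := by
  simp only [Ad_eq_modelDeriv, one_mul, inv_one, mul_one, modelDeriv_id]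

theorem coadj_one (z : E →L[ℂ] ℂ) : coadj (1 : G) z = z := by
  rw [coadj, Ad_one, ContinuousLinearMap.comp_id]

variable [LieGroup 𝓘(ℂ, E) ∞ G]

theorem mdifferentiable_conj (g : G) :
    MDifferentiable 𝓘(ℂ, E) 𝓘(ℂ, E) (fun x : G => g * x * g⁻¹) :=
  (contMDiff_mul_right.comp (contMDiff_mul_left (n := ∞))).mdifferentiable (by simp)

theorem Ad_mul (g h : G) : Ad (E := E) (g * h) = (Ad g).comp (Ad h) := by
  have hcomp := modelDeriv_comp (1 : G) (mdifferentiable_conj (E := E) g (h * 1 * h⁻¹))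
    (mdifferentiable_conj (E := E) h 1)
  rw [mul_one, mul_inv_cancel] at hcomp
  rw [Ad_eq_modelDeriv, Ad_eq_modelDeriv, Ad_eq_modelDeriv, ← hcomp]
  congr 1
  ext x
  group

theorem coadj_mul (g h : G) (z : E →L[ℂ] ℂ) : coadj (g * h) z = coadj h (coadj g z) := by
  rw [coadj, coadj, coadj, Ad_mul, ContinuousLinearMap.comp_assoc]

theorem contMDiff_Ad : ContMDiff 𝓘(ℂ, E) 𝓘(ℂ, E →L[ℂ] E) ∞ (Ad : G → E →L[ℂ] E) := by
  intro g₀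
  have hconj : ContMDiff (𝓘(ℂ, E).prod 𝓘(ℂ, E)) 𝓘(ℂ, E) ∞
      (uncurry fun g x : G => g * x * g⁻¹) :=
    (contMDiff_fst.mul contMDiff_snd).mul contMDiff_fst.inv
  refine (ContMDiffAt.mfderiv (m := ∞) (n := ∞) (fun g x : G => g * x * g⁻¹)
    (fun _ : G => (1 : G)) (x₀ := g₀) (hconj _) contMDiffAt_const (by simp))
    |>.congr_of_eventuallyEq (.of_forall fun g => ?_)
  have hfix : ∀ g : G, g * 1 * g⁻¹ = 1 := fun g => by rw [mul_one, mul_inv_cancel]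
  have hsource : (1 : G) ∈ (chartAt E (1 : G)).source := mem_chart_source E 1
  refine ((inTangentCoordinates_eq (I := 𝓘(ℂ, E)) (I' := 𝓘(ℂ, E)) (fun _ : G => (1 : G))
    (fun g : G => g * 1 * g⁻¹) (fun g => (Ad g : E →L[ℂ] E)) (x₀ := g₀) (x := g) hsource
    (by simpa only [hfix] using hsource)).trans ?_).symm
  ext v
  simp only [hfix, ContinuousLinearMap.comp_apply]
  rw [(tangentBundleCore 𝓘(ℂ, E) G).coordChange_self (achart E (1 : G)) 1 hsource,
    (tangentBundleCore 𝓘(ℂ, E) G).coordChange_self (achart E (1 : G)) 1 hsource]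

theorem contMDiff_Ad_apply (X : E) : ContMDiff 𝓘(ℂ, E) 𝓘(ℂ, E) ∞ (fun g : G => Ad g X) :=
  (ContinuousLinearMap.apply ℂ E X).contMDiff.comp contMDiff_Ad

variable (E) in
/-- The coadjoint action of `g` as a linear automorphism of `𝔤*`. -/
def coadjEquiv (g : G) : (E →L[ℂ] ℂ) ≃L[ℂ] (E →L[ℂ] ℂ) :=
  .equivOfInverse ((ContinuousLinearMap.compL ℂ E E ℂ).flip (Ad g))
    ((ContinuousLinearMap.compL ℂ E E ℂ).flip (Ad g⁻¹))
    (fun z => by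
      change coadj g⁻¹ (coadj g z) = z
      rw [← coadj_mul, mul_inv_cancel, coadj_one])
    (fun z => by
      change coadj g (coadj g⁻¹ z) = z
      rw [← coadj_mul, inv_mul_cancel, coadj_one])

theorem isOrbitMap_coadj (z : E →L[ℂ] ℂ) :
    IsOrbitMap E (coadjEquiv E : G → _) (fun g => coadj g z) where
  contMDiff := ((ContinuousLinearMap.compL ℂ E E ℂ) z).contMDiff.comp contMDiff_Ad
  map_mul x g := coadj_mul x g z

end Adjoint

/-! ### The multiplication of a Lie group in a chart -/

section ChartMul

variable {𝕜 : Type*} [RCLike 𝕜] {E : Type*} [NormedAddCommGroup E] [NormedSpace 𝕜 E]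
  {G : Type*} [TopologicalSpace G] [ChartedSpace E G] [Group G]

variable (𝕜 E G) in
/-- The multiplication of the group in the chart at `1`. -/
def chartMul (p : E × E) : E :=
  extChartAt 𝓘(𝕜, E) (1 : G) ((extChartAt 𝓘(𝕜, E) (1 : G)).symm p.1 *
    (extChartAt 𝓘(𝕜, E) (1 : G)).symm p.2)

theorem modelDeriv_extChartAt_self {M : Type*} [TopologicalSpace M] [ChartedSpace E M]
    [IsManifold 𝓘(𝕜, E) 1 M] (x : M) :
    modelDeriv 𝕜 E E (extChartAt 𝓘(𝕜, E) x) x = ContinuousLinearMap.id 𝕜 E :=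
  (modelDeriv_chartAt_comp (f := fun y => y) mdifferentiableAt_id
    (mdifferentiableAt_extChartAt (mem_chart_source E x))).trans (modelDeriv_id x)

variable [LieGroup 𝓘(𝕜, E) ∞ G]

theorem mdifferentiableAt_extChartAt_symm_apply {x : E}
    (hx : x ∈ (extChartAt 𝓘(𝕜, E) (1 : G)).target) :
    MDifferentiableAt 𝓘(𝕜, E) 𝓘(𝕜, E)
      (extChartAt 𝓘(𝕜, E) (1 : G)) ((extChartAt 𝓘(𝕜, E) (1 : G)).symm x) :=
  mdifferentiableAt_extChartAt (by simpa only [extChartAt_source] using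
    (extChartAt 𝓘(𝕜, E) (1 : G)).map_target hx)

theorem contDiffAt_chartMul {x y : E} (hx : x ∈ (extChartAt 𝓘(𝕜, E) (1 : G)).target)
    (hy : y ∈ (extChartAt 𝓘(𝕜, E) (1 : G)).target)
    (hxy : (extChartAt 𝓘(𝕜, E) (1 : G)).symm x * (extChartAt 𝓘(𝕜, E) (1 : G)).symm y ∈
      (extChartAt 𝓘(𝕜, E) (1 : G)).source) : ContDiffAt 𝕜 ∞ (chartMul 𝕜 E G) (x, y) := by
  have hsymm {x : E} (hx : x ∈ (extChartAt 𝓘(𝕜, E) (1 : G)).target) :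
      ContMDiffAt 𝓘(𝕜, E) 𝓘(𝕜, E) ∞ (extChartAt 𝓘(𝕜, E) (1 : G)).symm x :=
    (contMDiffOn_extChartAt_symm (1 : G)).contMDiffAt ((isOpen_extChartAt_target 1).mem_nhds hx)
  have hfst : ContMDiffAt 𝓘(𝕜, E × E) 𝓘(𝕜, E) ∞
      (fun p : E × E => (extChartAt 𝓘(𝕜, E) (1 : G)).symm p.1) (x, y) :=
    ContMDiffAt.comp (x, y) (hsymm hx) contDiff_fst.contMDiff.contMDiffAt
  have hsnd : ContMDiffAt 𝓘(𝕜, E × E) 𝓘(𝕜, E) ∞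
      (fun p : E × E => (extChartAt 𝓘(𝕜, E) (1 : G)).symm p.2) (x, y) :=
    ContMDiffAt.comp (x, y) (hsymm hy) contDiff_snd.contMDiff.contMDiffAt
  exact contMDiffAt_iff_contDiffAt.1 (ContMDiffAt.comp (x, y)
    (contMDiffAt_extChartAt' (by simpa only [extChartAt_source] using hxy)) (hfst.mul hsnd))

theorem contDiffAt_chartMul_one : ContDiffAt 𝕜 ∞ (chartMul 𝕜 E G)
    (extChartAt 𝓘(𝕜, E) (1 : G) 1, extChartAt 𝓘(𝕜, E) (1 : G) 1) :=
  contDiffAt_chartMul (mem_extChartAt_target 1) (mem_extChartAt_target 1) (by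
    rw [extChartAt_to_inv, one_mul]
    exact mem_extChartAt_source 1)

theorem modelDeriv_chart_mul_left {x : E} (hx : x ∈ (extChartAt 𝓘(𝕜, E) (1 : G)).target) (w : E) :
    modelDeriv 𝕜 E E (fun y : G => extChartAt 𝓘(𝕜, E) (1 : G)
      ((extChartAt 𝓘(𝕜, E) (1 : G)).symm x * y)) 1 w =
    fderiv 𝕜 (chartMul 𝕜 E G) (x, extChartAt 𝓘(𝕜, E) (1 : G) 1) (0, w) := by
  set φ := extChartAt 𝓘(𝕜, E) (1 : G) with hφ
  have hφ1 : φ.symm (φ 1) = 1 := extChartAt_to_inv 1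
  have hd : MDifferentiableAt 𝓘(𝕜, E) 𝓘(𝕜, E) (fun y : G => φ (φ.symm x * y)) 1 :=
    MDifferentiableAt.comp (1 : G)
      (by rw [mul_one]; exact mdifferentiableAt_extChartAt_symm_apply hx)
      ((contMDiff_mul_left (n := ∞)).mdifferentiable (by simp) _)
  have hmul : DifferentiableAt 𝕜 (chartMul 𝕜 E G) (x, φ 1) :=
    (contDiffAt_chartMul hx (mem_extChartAt_target 1) (by
      rw [← hφ, hφ1, mul_one]; exact φ.map_target hx)).differentiableAt (by simp)
  rw [modelDeriv_eq_fderiv_chart hd]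
  exact DFunLike.congr_fun
    (hmul.hasFDerivAt.comp (φ 1) (hasFDerivAt_prodMk_right x (φ 1))).fderiv w

theorem modelDeriv_chart_mul_right {x : E} (hx : x ∈ (extChartAt 𝓘(𝕜, E) (1 : G)).target) (w : E) :
    modelDeriv 𝕜 E E (fun y : G => extChartAt 𝓘(𝕜, E) (1 : G)
      (y * (extChartAt 𝓘(𝕜, E) (1 : G)).symm x)) 1 w =
    fderiv 𝕜 (chartMul 𝕜 E G) (extChartAt 𝓘(𝕜, E) (1 : G) 1, x) (w, 0) := by
  set φ := extChartAt 𝓘(𝕜, E) (1 : G) with hφ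
  have hφ1 : φ.symm (φ 1) = 1 := extChartAt_to_inv 1
  have hd : MDifferentiableAt 𝓘(𝕜, E) 𝓘(𝕜, E) (fun y : G => φ (y * φ.symm x)) 1 :=
    MDifferentiableAt.comp (1 : G)
      (by rw [one_mul]; exact mdifferentiableAt_extChartAt_symm_apply hx)
      ((contMDiff_mul_right (n := ∞)).mdifferentiable (by simp) _)
  have hmul : DifferentiableAt 𝕜 (chartMul 𝕜 E G) (φ 1, x) :=
    (contDiffAt_chartMul (mem_extChartAt_target 1) hx (by
      rw [← hφ, hφ1, one_mul]; exact φ.map_target hx)).differentiableAt (by simp)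
  rw [modelDeriv_eq_fderiv_chart hd]
  exact DFunLike.congr_fun (HasFDerivAt.comp (f := fun y => (y, x)) (φ 1) hmul.hasFDerivAt
    (hasFDerivAt_prodMk_left (φ 1) x)).fderiv w

theorem fderiv_chartMul_one_inr (w : E) : fderiv 𝕜 (chartMul 𝕜 E G)
    (extChartAt 𝓘(𝕜, E) (1 : G) 1, extChartAt 𝓘(𝕜, E) (1 : G) 1) (0, w) = w := by
  have : IsManifold 𝓘(𝕜, E) 1 G := .of_le (n := ∞) (by simp)
  rw [← modelDeriv_chart_mul_left (mem_extChartAt_target 1), extChartAt_to_inv]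
  simp only [one_mul]
  exact DFunLike.congr_fun (modelDeriv_extChartAt_self 1) w

theorem fderiv_chartMul_one_inl (w : E) : fderiv 𝕜 (chartMul 𝕜 E G)
    (extChartAt 𝓘(𝕜, E) (1 : G) 1, extChartAt 𝓘(𝕜, E) (1 : G) 1) (w, 0) = w := by
  have : IsManifold 𝓘(𝕜, E) 1 G := .of_le (n := ∞) (by simp)
  rw [← modelDeriv_chart_mul_right (mem_extChartAt_target 1), extChartAt_to_inv]
  simp only [mul_one]
  exact DFunLike.congr_fun (modelDeriv_extChartAt_self 1) w

theorem hasFDerivAt_fderiv_chartMul : HasFDerivAt (fderiv 𝕜 (chartMul 𝕜 E G))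
    (fderiv 𝕜 (fderiv 𝕜 (chartMul 𝕜 E G))
      (extChartAt 𝓘(𝕜, E) (1 : G) 1, extChartAt 𝓘(𝕜, E) (1 : G) 1))
    (extChartAt 𝓘(𝕜, E) (1 : G) 1, extChartAt 𝓘(𝕜, E) (1 : G) 1) :=
  ((contDiffAt_chartMul_one.fderiv_right (m := ∞) (by simp)).differentiableAt
    (by simp)).hasFDerivAt

theorem hasFDerivAt_fderiv_chartMul_inr (w : E) :
    HasFDerivAt (fun x => fderiv 𝕜 (chartMul 𝕜 E G) (x, extChartAt 𝓘(𝕜, E) (1 : G) 1) (0, w))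
      (((ContinuousLinearMap.apply 𝕜 E ((0 : E), w)).comp
        (fderiv 𝕜 (fderiv 𝕜 (chartMul 𝕜 E G))
          (extChartAt 𝓘(𝕜, E) (1 : G) 1, extChartAt 𝓘(𝕜, E) (1 : G) 1))).comp
        (ContinuousLinearMap.inl 𝕜 E E)) (extChartAt 𝓘(𝕜, E) (1 : G) 1) :=
  HasFDerivAt.comp (f := fun x => (x, extChartAt 𝓘(𝕜, E) (1 : G) 1)) _
    ((ContinuousLinearMap.apply 𝕜 E ((0 : E), w)).hasFDerivAt.comp _ hasFDerivAt_fderiv_chartMul)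
    (hasFDerivAt_prodMk_left _ _)

variable (𝕜 G) in
/-- The left invariant vector field with value `w` at `1`, in the chart at `1`. -/
def chartField (w : E) : E → E :=
  VectorField.mpullbackWithin 𝓘(𝕜, E) 𝓘(𝕜, E) (extChartAt 𝓘(𝕜, E) (1 : G)).symm
    (mulInvariantVectorField (I := 𝓘(𝕜, E)) (G := G) w) (range 𝓘(𝕜, E))

theorem chartField_eq_fderiv_chartMul {x : E} (hx : x ∈ (extChartAt 𝓘(𝕜, E) (1 : G)).target)
    (w : E) : chartField 𝕜 G w x =
      fderiv 𝕜 (chartMul 𝕜 E G) (x, extChartAt 𝓘(𝕜, E) (1 : G) 1) (0, w) := by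
  set φ := extChartAt 𝓘(𝕜, E) (1 : G) with hφ
  have : IsManifold 𝓘(𝕜, E) 1 G := .of_le (n := ∞) (by simp)
  have hcomp := modelDeriv_comp (g := φ) (f := fun y : G => φ.symm x * y) 1
    (by rw [mul_one]; exact mdifferentiableAt_extChartAt_symm_apply hx)
    ((contMDiff_mul_left (n := ∞)).mdifferentiable (by simp) _)
  rw [mul_one] at hcomp
  rw [← modelDeriv_chart_mul_left hx w, ← hφ, hcomp]
  change (mfderivWithin 𝓘(𝕜, E) 𝓘(𝕜, E) φ.symm (range 𝓘(𝕜, E)) x).inverse _ = _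
  rw [ContinuousLinearMap.inverse_eq
    (mfderivWithin_extChartAt_symm_comp_mfderiv_extChartAt (I := 𝓘(𝕜, E)) hx)
    (mfderiv_extChartAt_comp_mfderivWithin_extChartAt_symm (I := 𝓘(𝕜, E)) hx)]
  rfl

theorem lieBracket_chartField (v w : E) :
    VectorField.lieBracket 𝕜 (chartField 𝕜 G v) (chartField 𝕜 G w)
        (extChartAt 𝓘(𝕜, E) (1 : G) 1) =
      fderiv 𝕜 (fderiv 𝕜 (chartMul 𝕜 E G))
        (extChartAt 𝓘(𝕜, E) (1 : G) 1, extChartAt 𝓘(𝕜, E) (1 : G) 1) (v, 0) (0, w) -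
      fderiv 𝕜 (fderiv 𝕜 (chartMul 𝕜 E G))
        (extChartAt 𝓘(𝕜, E) (1 : G) 1, extChartAt 𝓘(𝕜, E) (1 : G) 1) (w, 0) (0, v) := by
  have hfield : ∀ u : E, chartField 𝕜 G u =ᶠ[𝓝 (extChartAt 𝓘(𝕜, E) (1 : G) 1)]
      fun x => fderiv 𝕜 (chartMul 𝕜 E G) (x, extChartAt 𝓘(𝕜, E) (1 : G) 1) (0, u) := by
    intro u
    filter_upwards [extChartAt_target_mem_nhds (I := 𝓘(𝕜, E)) (1 : G)] with x hx
    exact chartField_eq_fderiv_chartMul hx u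
  rw [Filter.EventuallyEq.lieBracket_vectorField_eq (hfield v) (hfield w), VectorField.lieBracket,
    fderiv_chartMul_one_inr, fderiv_chartMul_one_inr, (hasFDerivAt_fderiv_chartMul_inr v).fderiv,
    (hasFDerivAt_fderiv_chartMul_inr w).fderiv]
  rfl

theorem isSymmSndFDerivAt_chartMul : IsSymmSndFDerivAt 𝕜 (chartMul 𝕜 E G)
    (extChartAt 𝓘(𝕜, E) (1 : G) 1, extChartAt 𝓘(𝕜, E) (1 : G) 1) :=
  contDiffAt_chartMul_one.isSymmSndFDerivAt (by
    rw [minSmoothness_of_isRCLikeNormedField]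
    exact WithTop.coe_le_coe.2 (le_top : (2 : ℕ∞) ≤ ⊤))

end ChartMul

/-! ### The derivative of the adjoint representation -/

section Adjoint

variable {E : Type u} [NormedAddCommGroup E] [NormedSpace ℂ E]
  {G : Type*} [TopologicalSpace G] [ChartedSpace E G] [Group G] [LieGroup 𝓘(ℂ, E) ∞ G]

theorem bracket_eq_lieBracket_chartField [FiniteDimensional ℂ E] (v w : E) :
    bracket E G v w = VectorField.lieBracket ℂ (chartField ℂ G v) (chartField ℂ G w)
      (extChartAt 𝓘(ℂ, E) (1 : G) 1) := by
  have : IsManifold 𝓘(ℂ, E) 1 G := .of_le (n := ∞) (by simp)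
  have hdef : bracket E G v w = (modelDeriv ℂ E E (extChartAt 𝓘(ℂ, E) (1 : G)) 1).inverse
      (VectorField.lieBracketWithin ℂ (chartField ℂ G v) (chartField ℂ G w)
        ((extChartAt 𝓘(ℂ, E) (1 : G)).symm ⁻¹' univ ∩ range 𝓘(ℂ, E))
        (extChartAt 𝓘(ℂ, E) (1 : G) 1)) := rfl
  rw [hdef, modelDeriv_extChartAt_self, ContinuousLinearMap.inverse_id, preimage_univ, univ_inter,
    modelWithCornersSelf_coe, range_id, VectorField.lieBracketWithin_univ]
  rfl

theorem fderiv_chartMul_Ad {x : E} (hx : x ∈ (extChartAt 𝓘(ℂ, E) (1 : G)).target) (w : E) :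
    fderiv ℂ (chartMul ℂ E G) (extChartAt 𝓘(ℂ, E) (1 : G) 1, x)
        (Ad ((extChartAt 𝓘(ℂ, E) (1 : G)).symm x) w, 0) =
      fderiv ℂ (chartMul ℂ E G) (x, extChartAt 𝓘(ℂ, E) (1 : G) 1) (0, w) := by
  rw [← modelDeriv_chart_mul_left hx, ← modelDeriv_chart_mul_right hx, Ad_eq_modelDeriv]
  set φ := extChartAt 𝓘(ℂ, E) (1 : G)
  have hcomp := modelDeriv_comp (g := fun y => φ (y * φ.symm x))
    (f := fun y : G => φ.symm x * y * (φ.symm x)⁻¹) 1 (by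
      rw [mul_one, mul_inv_cancel]
      exact MDifferentiableAt.comp (1 : G)
        (by rw [one_mul]; exact mdifferentiableAt_extChartAt_symm_apply hx)
        ((contMDiff_mul_right (n := ∞)).mdifferentiable (by simp) _))
    (mdifferentiable_conj (E := E) (φ.symm x) 1)
  simp only [inv_mul_cancel_right, mul_one, mul_inv_cancel] at hcomp
  rw [hcomp]
  rfl

theorem hasFDerivAt_Ad_chart : HasFDerivAt
    (fun x => Ad (E := E) ((extChartAt 𝓘(ℂ, E) (1 : G)).symm x))
    (modelDeriv ℂ E (E →L[ℂ] E) (Ad : G → E →L[ℂ] E) 1) (extChartAt 𝓘(ℂ, E) (1 : G) 1) := by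
  have hsymm : MDifferentiableAt 𝓘(ℂ, E) 𝓘(ℂ, E) (extChartAt 𝓘(ℂ, E) (1 : G)).symm
      (extChartAt 𝓘(ℂ, E) (1 : G) 1) :=
    ((contMDiffOn_extChartAt_symm (n := ∞) (1 : G)).contMDiffAt
      (extChartAt_target_mem_nhds 1)).mdifferentiableAt (by simp)
  have hAd : MDifferentiable 𝓘(ℂ, E) 𝓘(ℂ, E →L[ℂ] E) (Ad : G → E →L[ℂ] E) :=
    contMDiff_Ad.mdifferentiable (by simp)
  rw [modelDeriv_eq_fderiv_chart (hAd 1)]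
  exact ((hAd _).comp _ hsymm).differentiableAt.hasFDerivAt

/-- This is the derivative at `1`, in direction `v`, of the identity
`d(m(1, x))(Ad x w, 0) = d(m(x, 1))(0, w)`, which says that `Ad x` relates the two translations. -/
theorem fderiv_fderiv_chartMul_add_modelDeriv_Ad (v w : E) :
    fderiv ℂ (fderiv ℂ (chartMul ℂ E G))
        (extChartAt 𝓘(ℂ, E) (1 : G) 1, extChartAt 𝓘(ℂ, E) (1 : G) 1) (0, v) (w, 0) +
      modelDeriv ℂ E (E →L[ℂ] E) (Ad : G → E →L[ℂ] E) 1 v w =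
    fderiv ℂ (fderiv ℂ (chartMul ℂ E G))
        (extChartAt 𝓘(ℂ, E) (1 : G) 1, extChartAt 𝓘(ℂ, E) (1 : G) 1) (v, 0) (0, w) := by
  set φ := extChartAt 𝓘(ℂ, E) (1 : G)
  have hφ1 : φ.symm (φ 1) = 1 := extChartAt_to_inv 1
  have hmul : HasFDerivAt (fun x => fderiv ℂ (chartMul ℂ E G) (φ 1, x))
      ((fderiv ℂ (fderiv ℂ (chartMul ℂ E G)) (φ 1, φ 1)).comp (ContinuousLinearMap.inr ℂ E E))
      (φ 1) :=
    hasFDerivAt_fderiv_chartMul.comp (φ 1) (hasFDerivAt_prodMk_right (φ 1) (φ 1))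
  have harg : HasFDerivAt (fun x => (Ad (E := E) (φ.symm x) w, (0 : E)))
      ((ContinuousLinearMap.inl ℂ E E).comp ((ContinuousLinearMap.apply ℂ E w).comp
        (modelDeriv ℂ E (E →L[ℂ] E) (Ad : G → E →L[ℂ] E) 1))) (φ 1) :=
    (ContinuousLinearMap.inl ℂ E E).hasFDerivAt.comp (φ 1)
      ((ContinuousLinearMap.apply ℂ E w).hasFDerivAt.comp (φ 1) hasFDerivAt_Ad_chart)
  have heq : (fun x => fderiv ℂ (chartMul ℂ E G) (φ 1, x) (Ad (E := E) (φ.symm x) w, (0 : E)))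
      =ᶠ[𝓝 (φ 1)] fun x => fderiv ℂ (chartMul ℂ E G) (x, φ 1) (0, w) := by
    filter_upwards [extChartAt_target_mem_nhds (I := 𝓘(ℂ, E)) (1 : G)] with x hx
    exact fderiv_chartMul_Ad hx w
  have hone : ∀ u : E, fderiv ℂ (chartMul ℂ E G) (φ 1, φ 1) (u, 0) = u := fderiv_chartMul_one_inl
  have h := DFunLike.congr_fun ((hmul.clm_apply harg).unique
    (heq.hasFDerivAt_iff.2 (hasFDerivAt_fderiv_chartMul_inr w))) v
  simp only [hφ1, Ad_one, add_apply, ContinuousLinearMap.comp_apply,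
    ContinuousLinearMap.flip_apply, ContinuousLinearMap.apply_apply, ContinuousLinearMap.inl_apply,
    ContinuousLinearMap.inr_apply, ContinuousLinearMap.id_apply, hone] at h
  rw [← h, add_comm]

theorem modelDeriv_Ad [FiniteDimensional ℂ E] (v w : E) :
    modelDeriv ℂ E (E →L[ℂ] E) (Ad : G → E →L[ℂ] E) 1 v w = bracket E G v w := by
  rw [bracket_eq_lieBracket_chartField, lieBracket_chartField,
    ← fderiv_fderiv_chartMul_add_modelDeriv_Ad v w, isSymmSndFDerivAt_chartMul.eq (w, 0) (0, v),
    add_sub_cancel_left]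

theorem modelDeriv_Ad_apply [FiniteDimensional ℂ E] (X Y : E) :
    modelDeriv ℂ E E (fun g : G => Ad g Y) 1 X = bracket E G X Y :=
  (DFunLike.congr_fun (modelDeriv_clm_comp (ContinuousLinearMap.apply ℂ E Y)
    (contMDiff_Ad.mdifferentiable (by simp) (1 : G))) X).trans (modelDeriv_Ad X Y)

end Adjoint

/-! ### The tangent spaces of the coadjoint orbits -/

section Coadjoint

variable {E : Type u} [NormedAddCommGroup E] [NormedSpace ℂ E] [FiniteDimensional ℂ E]
  {G : Type*} [TopologicalSpace G] [ChartedSpace E G] [Group G] [LieGroup 𝓘(ℂ, E) ∞ G]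

theorem modelDeriv_coadj_one (z : E →L[ℂ] ℂ) (X : E) :
    modelDeriv ℂ E (E →L[ℂ] ℂ) (fun g : G => coadj g z) 1 X = sharp G z X := by
  have h := modelDeriv_clm_comp ((ContinuousLinearMap.compL ℂ E E ℂ) z)
    (contMDiff_Ad.mdifferentiable (by simp) (1 : G))
  refine (DFunLike.congr_fun h X).trans ?_
  ext Y
  exact congrArg z (modelDeriv_Ad X Y)

theorem range_modelDeriv_coadj (z : E →L[ℂ] ℂ) (g : G) :
    (modelDeriv ℂ E (E →L[ℂ] ℂ) (fun g : G => coadj g z) g).range =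
      charSubspace G (coadj g z) := by
  rw [range_modelDeriv_eq_range_modelDeriv_mul_left
    ((isOrbitMap_coadj z).contMDiff.mdifferentiable (by simp))]
  simp only [coadj_mul]
  exact congrArg LinearMap.range (LinearMap.ext (modelDeriv_coadj_one _))

theorem charSubspace_coadj (z : E →L[ℂ] ℂ) (g : G) :
    charSubspace G (coadj g z) =
      (charSubspace G z).map (coadjEquiv E g : (E →L[ℂ] ℂ) →L[ℂ] _).toLinearMap := by
  rw [← range_modelDeriv_coadj, (isOrbitMap_coadj z).range_modelDeriv g, range_modelDeriv_coadj,
    coadj_one]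

theorem coadj_notMem_Sing {z : E →L[ℂ] ℂ} (hz : z ∉ Sing E G) (g : G) :
    coadj g z ∉ Sing E G := by
  rintro ⟨w, hw⟩
  rw [charSubspace_coadj] at hw
  exact hz ⟨w, hw.trans_eq' ((coadjEquiv E g).toLinearEquiv.finrank_map_eq _)⟩

end Coadjoint

/-! ### Regular points -/

section Regular

theorem apply_mem_range_of_finrank_range_add_smul_le {𝕜 E F : Type*} [NontriviallyNormedField 𝕜]
    [CompleteSpace 𝕜] [NormedAddCommGroup E] [NormedSpace 𝕜 E] [NormedAddCommGroup F]
    [NormedSpace 𝕜 F] [FiniteDimensional 𝕜 F] {A C : E →L[𝕜] F}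
    (h : ∀ t : 𝕜, Module.finrank 𝕜 (A + t • C).range ≤ Module.finrank 𝕜 A.range) {x : E}
    (hx : A x = 0) : C x ∈ A.range := by
  by_contra hCx
  let B (t : 𝕜) : E × 𝕜 →L[𝕜] F := (A + t • C).coprod (.toSpanSingleton 𝕜 (C x))
  have hB (t : 𝕜) : (B t).range = (A + t • C).range ⊔ 𝕜 ∙ C x := by
    rw [ContinuousLinearMap.range_coprod]
    congr 1
    exact LinearMap.range_toSpanSingleton (C x)
  have hBt {t : 𝕜} (ht : t ≠ 0) : (B t).range = (A + t • C).range := by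
    rw [hB, sup_eq_left, Submodule.span_singleton_le_iff_mem]
    refine ⟨t⁻¹ • x, ?_⟩
    simp [hx, smul_smul, ht]
  have hB0 : Module.finrank 𝕜 (B 0).range = Module.finrank 𝕜 A.range + 1 := by
    rw [hB, zero_smul, add_zero, Submodule.finrank_sup_span_singleton hCx]
  have hcont : Continuous B := by fun_prop
  have hrank (t : 𝕜) (n : ℕ) :
      n ≤ (B t : E × 𝕜 →ₗ[𝕜] F).rank ↔ n ≤ Module.finrank 𝕜 (B t).range := by
    rw [LinearMap.rank, ← Module.finrank_eq_rank, Nat.cast_le]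
  have hev : ∀ᶠ t in 𝓝 (0 : 𝕜), Module.finrank 𝕜 A.range + 1 ≤ Module.finrank 𝕜 (B t).range := by
    simp only [← hrank]
    exact ((isOpen_setOfPred_nat_le_rank _).preimage hcont).mem_nhds ((hrank 0 _).2 hB0.ge)
  obtain ⟨t, ht, ht0⟩ :=
    ((hev.filter_mono nhdsWithin_le_nhds).and (self_mem_nhdsWithin (s := {0}ᶜ))).exists
  rw [hBt ht0] at ht
  exact absurd (h t) (by omega)

variable {E : Type u} [NormedAddCommGroup E] [NormedSpace ℂ E] [FiniteDimensional ℂ E]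
  {G : Type*} [TopologicalSpace G] [ChartedSpace E G] [Group G] [LieGroup 𝓘(ℂ, E) ∞ G]

theorem sharp_skew (z : E →L[ℂ] ℂ) (X Y : E) : sharp G z X Y = -sharp G z Y X := by
  rw [sharp_apply, sharp_apply, bracket_skew, map_neg]

/-- For `w ∈ 𝔤*`, the rank of `c^♯` along the line `z + t w` is maximal at `t = 0`. Hence
`c_w^♯ X = c_z^♯ U` for some `U`, so that `w([X, Y]) = z([U, Y]) = 0`. -/
theorem bracket_eq_zero_of_notMem_Sing {z : E →L[ℂ] ℂ} (hz : z ∉ Sing E G) {X Y : E}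
    (hX : sharp G z X = 0) (hY : sharp G z Y = 0) : bracket E G X Y = 0 := by
  refine SeparatingDual.eq_zero_of_forall_dual_eq_zero (R := ℂ) fun w => ?_
  have hline (t : ℂ) : (sharp G z).toContinuousLinearMap + t • (sharp G w).toContinuousLinearMap =
      (sharp G (z + t • w)).toContinuousLinearMap := by
    ext U W
    simp
  obtain ⟨U, hU : sharp G z U = sharp G w X⟩ :=
    apply_mem_range_of_finrank_range_add_smul_le (A := (sharp G z).toContinuousLinearMap)
      (C := (sharp G w).toContinuousLinearMap)
      (fun t => not_lt.1 fun hlt => hz ⟨z + t • w, by rwa [hline] at hlt⟩) hX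
  calc w (bracket E G X Y) = sharp G z U Y := by rw [hU, sharp_apply]
    _ = 0 := by rw [sharp_skew, hY, zero_apply, neg_zero]

end Regular

/-! ### The conjugation with respect to the real form -/

section RealForm

variable {E₀ : Type*} [NormedAddCommGroup E₀] [NormedSpace ℝ E₀]
  {G₀ : Type*} [TopologicalSpace G₀] [ChartedSpace E₀ G₀] [Group G₀]
  {E : Type u} [NormedAddCommGroup E] [NormedSpace ℂ E]
  {G : Type*} [TopologicalSpace G] [ChartedSpace E G] [Group G]
  {ι : G₀ →* G}

theorem modelDeriv_comp_monoidHom_one {E' M : Type*} [NormedAddCommGroup E'] [NormedSpace ℂ E']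
    [TopologicalSpace M] [ChartedSpace E' M] {F : G → M}
    (hF : MDifferentiableAt 𝓘(ℂ, E) 𝓘(ℂ, E') F 1)
    (hι : MDifferentiableAt 𝓘(ℝ, E₀) 𝓘(ℝ, E) ι 1) (X : E₀) :
    modelDeriv ℝ E₀ E' (fun h => F (ι h)) 1 X =
      modelDeriv ℂ E E' F 1 (differentialAtOne E₀ E ι X) := by
  rw [← map_one ι] at hF
  rw [modelDeriv_comp 1 (hasMFDerivAt_real_of_complex hF).mdifferentiableAt hι,
    modelDeriv_real_of_complex hF, map_one]
  rfl

namespace IsComplexification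

theorem finiteDimensional [FiniteDimensional ℂ E] (hι : IsComplexification E₀ E ι) :
    FiniteDimensional ℝ E₀ := by
  have : FiniteDimensional ℝ E := FiniteDimensional.complexToReal E
  exact .of_injective (hι.equiv.toLinearMap ∘ₗ LinearMap.inl ℝ E₀ E₀)
    (hι.equiv.injective.comp LinearMap.inl_injective)

theorem conj_add_I_smul (hι : IsComplexification E₀ E ι) (X Y : E₀) :
    hι.conj (differentialAtOne E₀ E ι X + Complex.I • differentialAtOne E₀ E ι Y) =
      differentialAtOne E₀ E ι X - Complex.I • differentialAtOne E₀ E ι Y := by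
  rw [← hι.equiv_apply, conj, LinearEquiv.symm_apply_apply, hι.equiv_apply, map_neg, smul_neg,
    sub_eq_add_neg]

theorem exists_eq_add_I_smul (hι : IsComplexification E₀ E ι) (Z : E) :
    ∃ X Y, Z = differentialAtOne E₀ E ι X + Complex.I • differentialAtOne E₀ E ι Y :=
  ⟨_, _, (hι.equiv.apply_symm_apply Z).symm⟩

/-- The conjugation of `𝔤` as a continuous real linear map. -/
def conjL [FiniteDimensional ℂ E] (hι : IsComplexification E₀ E ι) : E →L[ℝ] E :=
  haveI : FiniteDimensional ℝ E := FiniteDimensional.complexToReal E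
  LinearMap.toContinuousLinearMap
    { toFun := hι.conj
      map_add' := hι.conj_add
      map_smul' := fun r Z => by
        rw [RingHom.id_apply, ← Complex.coe_smul, hι.conj_smul, Complex.conj_ofReal,
          Complex.coe_smul] }

variable [LieGroup 𝓘(ℂ, E) ∞ G]

theorem Ad_differentialAtOne_mem_range [LieGroup 𝓘(ℝ, E₀) ∞ G₀]
    (hι : IsComplexification E₀ E ι) (h : G₀) (X : E₀) :
    Ad (ι h) (differentialAtOne E₀ E ι X) ∈ range (differentialAtOne E₀ E ι) := by
  have hdι : MDifferentiable 𝓘(ℝ, E₀) 𝓘(ℝ, E) ι := hι.contMDiff.mdifferentiable (by simp)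
  have hconj : MDifferentiableAt 𝓘(ℝ, E₀) 𝓘(ℝ, E₀) (fun x : G₀ => h * x * h⁻¹) 1 :=
    (contMDiff_mul_right.comp (contMDiff_mul_left (n := ∞))).mdifferentiable (by simp) 1
  have hconjG : MDifferentiableAt 𝓘(ℂ, E) 𝓘(ℂ, E) (fun x : G => ι h * x * (ι h)⁻¹) 1 :=
    mdifferentiable_conj (ι h) 1
  have hcomm : (fun x => ι (h * x * h⁻¹)) = fun x => ι h * ι x * (ι h)⁻¹ := by
    simp only [map_mul, map_inv]
  have hleft := modelDeriv_comp (g := ι) 1 (hdι _) hconj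
  have hright := modelDeriv_comp_monoidHom_one hconjG (hdι 1) X
  rw [← hcomm, hleft] at hright
  simp only [mul_one, mul_inv_cancel] at hright
  exact ⟨_, hright⟩

theorem conj_Ad [LieGroup 𝓘(ℝ, E₀) ∞ G₀] (hι : IsComplexification E₀ E ι) (h : G₀) (Z : E) :
    hι.conj (Ad (ι h) Z) = Ad (ι h) (hι.conj Z) := by
  obtain ⟨X, Y, rfl⟩ := hι.exists_eq_add_I_smul Z
  obtain ⟨X', hX'⟩ := hι.Ad_differentialAtOne_mem_range h X
  obtain ⟨Y', hY'⟩ := hι.Ad_differentialAtOne_mem_range h Y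
  rw [hι.conj_add_I_smul, map_add, map_sub, map_smul, ← hX', ← hY', hι.conj_add_I_smul]

variable [FiniteDimensional ℂ E]

theorem modelDeriv_Ad_apply (hι : IsComplexification E₀ E ι) (Z : E) (X : E₀) :
    modelDeriv ℝ E₀ E (fun h => Ad (ι h) Z) 1 X =
      bracket E G (differentialAtOne E₀ E ι X) Z := by
  rw [modelDeriv_comp_monoidHom_one ((contMDiff_Ad_apply Z).mdifferentiable (by simp) 1)
    (hι.contMDiff.mdifferentiable (by simp) 1), CoadjointCR.modelDeriv_Ad_apply]

theorem conj_bracket [LieGroup 𝓘(ℝ, E₀) ∞ G₀] (hι : IsComplexification E₀ E ι) (Z W : E) :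
    hι.conj (bracket E G Z W) = bracket E G (hι.conj Z) (hι.conj W) := by
  have hreal (X : E₀) : hι.conj (bracket E G (differentialAtOne E₀ E ι X) W) =
      bracket E G (differentialAtOne E₀ E ι X) (hι.conj W) := by
    rw [← hι.modelDeriv_Ad_apply, ← hι.modelDeriv_Ad_apply, ← funext fun h => hι.conj_Ad h W]
    have hAd : MDifferentiableAt 𝓘(ℝ, E₀) 𝓘(ℝ, E) (fun h => Ad (ι h) W) 1 :=
      (contMDiff_real_of_complex (contMDiff_Ad_apply W)).comp hι.contMDiff |>.mdifferentiable
        (by simp) 1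
    exact DFunLike.congr_fun (modelDeriv_clm_comp hι.conjL hAd).symm X
  obtain ⟨X, Y, rfl⟩ := hι.exists_eq_add_I_smul Z
  rw [hι.conj_add_I_smul]
  simp only [map_add, map_sub, map_smul, LinearMap.add_apply, LinearMap.sub_apply,
    LinearMap.smul_apply, hι.conj_add, hι.conj_smul, Complex.conj_I, hreal]
  module

theorem conjDual_coadj [LieGroup 𝓘(ℝ, E₀) ∞ G₀] (hι : IsComplexification E₀ E ι) (h : G₀)
    (z : E →L[ℂ] ℂ) : hι.conjDual (coadj (ι h) z) = coadj (ι h) (hι.conjDual z) := by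
  ext Z
  exact congrArg (fun Y => starRingEnd ℂ (z Y)) (hι.conj_Ad h Z).symm

theorem apply_bracket_sub_conj_eq_zero [LieGroup 𝓘(ℝ, E₀) ∞ G₀] (hι : IsComplexification E₀ E ι)
    {z : E →L[ℂ] ℂ} (hz : z ∉ Sing E G) {Z W : E} (hZ : sharp G z Z = 0)
    (hW : sharp G z W = 0) : z (bracket E G (Z - hι.conj Z) (W - hι.conj W)) = 0 := by
  have hconj : bracket E G (hι.conj Z) (hι.conj W) = 0 := by
    rw [← hι.conj_bracket, bracket_eq_zero_of_notMem_Sing hz hZ hW]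
    exact map_zero hι.conjL
  calc z (bracket E G (Z - hι.conj Z) (W - hι.conj W))
      = sharp G z Z (W - hι.conj W) + sharp G z W (hι.conj Z) +
          z (bracket E G (hι.conj Z) (hι.conj W)) := by
        rw [sharp_skew z W]
        simp only [sharp_apply, map_sub, LinearMap.sub_apply]
        ring
    _ = 0 := by rw [hZ, hW, hconj, zero_apply, zero_apply, map_zero, add_zero, add_zero]

theorem apply_bracket_eq_zero_of_sharp_eq_I_smul [LieGroup 𝓘(ℝ, E₀) ∞ G₀]
    (hι : IsComplexification E₀ E ι)
    {z : E →L[ℂ] ℂ} (hz : z ∉ Sing E G) {X X' Y Y' : E₀}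
    (hX : sharp G z (differentialAtOne E₀ E ι X') =
      Complex.I • sharp G z (differentialAtOne E₀ E ι X))
    (hY : sharp G z (differentialAtOne E₀ E ι Y') =
      Complex.I • sharp G z (differentialAtOne E₀ E ι Y)) :
    z (bracket E G (differentialAtOne E₀ E ι X) (differentialAtOne E₀ E ι Y)) = 0 := by
  set δ := differentialAtOne E₀ E ι
  have hker {A A' : E₀} (hA : sharp G z (δ A') = Complex.I • sharp G z (δ A)) :
      sharp G z (δ A' + Complex.I • δ (-A)) = 0 := by
    rw [map_neg, smul_neg, ← sub_eq_add_neg, map_sub, map_smul, hA, sub_self]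
  have hsub (A A' : E₀) : δ A' + Complex.I • δ (-A) - hι.conj (δ A' + Complex.I • δ (-A)) =
      (-2 * Complex.I) • δ A := by
    rw [hι.conj_add_I_smul, map_neg]
    module
  have h := hι.apply_bracket_sub_conj_eq_zero hz (hker hX) (hker hY)
  rw [hsub, hsub] at h
  simpa using h

end IsComplexification

end RealForm

/-! ### Tangent vectors of type `(1,0)` -/

section OneZero

variable {W : Type*} [AddCommGroup W] [Module ℂ W]

theorem smul_eq_re_smul_add_im_smul (c : ℂ) (w : W) : c • w = c.re • w + c.im • Complex.I • w := by
  conv_lhs => rw [← Complex.re_add_im c, add_smul, mul_smul, Complex.coe_smul, Complex.coe_smul]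

/-- The largest complex subspace `T ∩ i T` of a real subspace `T` of a complex vector space: the
complex tangent space of a CR submanifold, when `T` is its real tangent space. -/
def holPart (T : Submodule ℝ W) : Submodule ℂ W where
  carrier := {w | w ∈ T ∧ Complex.I • w ∈ T}
  zero_mem' := by simp
  add_mem' ha hb := ⟨add_mem ha.1 hb.1, by rw [smul_add]; exact add_mem ha.2 hb.2⟩
  smul_mem' c w hw := by
    have hmem (c : ℂ) : c • w ∈ T := by
      rw [smul_eq_re_smul_add_im_smul]
      exact add_mem (T.smul_mem _ hw.1) (T.smul_mem _ hw.2)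
    exact ⟨hmem c, by rw [smul_smul]; exact hmem _⟩

theorem holPart_map {W' : Type*} [AddCommGroup W'] [Module ℂ W'] {L : W →ₗ[ℂ] W'}
    (hL : Injective L) (T : Submodule ℝ W) :
    holPart (T.map (L.restrictScalars ℝ)) = (holPart T).map L := by
  ext w
  constructor
  · rintro ⟨⟨v, hv, rfl⟩, ⟨v', hv', hLv'⟩⟩
    obtain rfl : v' = Complex.I • v := hL (hLv'.trans (map_smul L _ v).symm)
    exact ⟨v, ⟨hv, hv'⟩, rfl⟩
  · rintro ⟨v, ⟨hv, hv'⟩, rfl⟩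
    exact ⟨⟨v, hv, rfl⟩, ⟨_, hv', map_smul L _ v⟩⟩

theorem finrank_holPart_map {W' : Type*} [AddCommGroup W'] [Module ℂ W'] {L : W →ₗ[ℂ] W'}
    (hL : Injective L) (T : Submodule ℝ W) :
    Module.finrank ℂ (holPart (T.map (L.restrictScalars ℝ))) = Module.finrank ℂ (holPart T) := by
  rw [holPart_map hL]
  exact (Submodule.equivMapOfInjective L hL _).symm.finrank_eq

theorem exists_one_tmul_add_I_tmul_of_mem_baseChange {V : Type*} [AddCommGroup V] [Module ℝ V]
    {T : Submodule ℝ V} {u : ℂ ⊗[ℝ] V} (hu : u ∈ T.baseChange ℂ) :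
    ∃ a ∈ T, ∃ b ∈ T, u = 1 ⊗ₜ a + Complex.I ⊗ₜ b := by
  obtain ⟨t, rfl⟩ := hu
  obtain ⟨c, rfl⟩ := TensorProduct.eq_repr_basis_left Complex.basisOneI t
  refine ⟨c 0, (c 0).2, c 1, (c 1).2, ?_⟩
  simp [Finsupp.sum_fintype, Fin.sum_univ_two, Complex.coe_basisOneI]

theorem eq_of_one_tmul_add_I_tmul_eq {V : Type*} [AddCommGroup V] [Module ℝ V] {a b a' b' : V}
    (h : (1 ⊗ₜ a + Complex.I ⊗ₜ b : ℂ ⊗[ℝ] V) = 1 ⊗ₜ a' + Complex.I ⊗ₜ b') : a = a' := by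
  simpa using congrArg (fun u => TensorProduct.lid ℝ V (LinearMap.rTensor V Complex.reLm u)) h

theorem exists_mem_holPart_of_mem_oneZeroPart {T : Submodule ℝ W} {u : ℂ ⊗[ℝ] W}
    (hu : u ∈ oneZeroPart T) :
    ∃ w ∈ holPart T, u = 1 ⊗ₜ w - Complex.I ⊗ₜ (Complex.I • w) := by
  obtain ⟨a, ha, b, hb, rfl⟩ := exists_one_tmul_add_I_tmul_of_mem_baseChange hu.1
  have hJ : (1 ⊗ₜ (Complex.I • a) + Complex.I ⊗ₜ (Complex.I • b) : ℂ ⊗[ℝ] W) =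
      Complex.I • (1 ⊗ₜ a + Complex.I ⊗ₜ b) := Module.End.mem_eigenspace_iff.1 hu.2
  have hI : Complex.I • a = -b := by
    refine eq_of_one_tmul_add_I_tmul_eq (b := Complex.I • b) (b' := a) (hJ.trans ?_)
    rw [smul_add, TensorProduct.smul_tmul', TensorProduct.smul_tmul', smul_eq_mul, smul_eq_mul,
      mul_one, Complex.I_mul_I, TensorProduct.neg_tmul, TensorProduct.tmul_neg, add_comm]
  refine ⟨a, ⟨ha, hI ▸ neg_mem hb⟩, ?_⟩
  rw [hI, TensorProduct.tmul_neg, sub_neg_eq_add]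

theorem one_tmul_sub_I_tmul_mem_oneZeroPart {T : Submodule ℝ W} {w : W} (hw : w ∈ holPart T) :
    1 ⊗ₜ w - Complex.I ⊗ₜ (Complex.I • w) ∈ oneZeroPart T := by
  refine ⟨sub_mem (Submodule.tmul_mem_baseChange_of_mem _ hw.1)
    (Submodule.tmul_mem_baseChange_of_mem _ hw.2), Module.End.mem_eigenspace_iff.2 ?_⟩
  have hJJ : complexStructure W (Complex.I • w) = -w := by
    change Complex.I • Complex.I • w = -w
    rw [smul_smul, Complex.I_mul_I, neg_one_smul]
  rw [map_sub, LinearMap.baseChange_tmul, LinearMap.baseChange_tmul, hJJ, smul_sub,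
    TensorProduct.smul_tmul', TensorProduct.smul_tmul', smul_eq_mul, smul_eq_mul, mul_one,
    Complex.I_mul_I, TensorProduct.neg_tmul, TensorProduct.tmul_neg, sub_neg_eq_add,
    sub_neg_eq_add, add_comm]
  rfl

theorem liftBaseChange_one_tmul_sub_I_tmul (w : W) :
    LinearMap.liftBaseChange ℂ (LinearMap.id : W →ₗ[ℝ] W)
      (1 ⊗ₜ w - Complex.I ⊗ₜ (Complex.I • w)) = (2 : ℂ) • w := by
  rw [map_sub, LinearMap.liftBaseChange_tmul, LinearMap.liftBaseChange_tmul, LinearMap.id_apply,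
    LinearMap.id_apply, one_smul, smul_smul, Complex.I_mul_I, neg_one_smul, sub_neg_eq_add,
    two_smul]

theorem oneZeroPart_map_liftBaseChange (T : Submodule ℝ W) :
    (oneZeroPart T).map (LinearMap.liftBaseChange ℂ (LinearMap.id : W →ₗ[ℝ] W)) = holPart T := by
  ext w
  constructor
  · rintro ⟨u, hu, rfl⟩
    obtain ⟨v, hv, rfl⟩ := exists_mem_holPart_of_mem_oneZeroPart hu
    rw [liftBaseChange_one_tmul_sub_I_tmul]
    exact Submodule.smul_mem _ _ hv
  · intro hw
    refine ⟨_, one_tmul_sub_I_tmul_mem_oneZeroPart (Submodule.smul_mem _ (2 : ℂ)⁻¹ hw), ?_⟩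
    rw [liftBaseChange_one_tmul_sub_I_tmul, smul_inv_smul₀ two_ne_zero]

theorem finrank_oneZeroPart (T : Submodule ℝ W) :
    Module.finrank ℂ (oneZeroPart T) = Module.finrank ℂ (holPart T) := by
  set μ := LinearMap.liftBaseChange ℂ (LinearMap.id : W →ₗ[ℝ] W)
  have hinj : Injective (μ.domRestrict (oneZeroPart T)) := by
    rintro ⟨u, hu⟩ ⟨u', hu'⟩ (h : μ u = μ u')
    obtain ⟨w, -, rfl⟩ := exists_mem_holPart_of_mem_oneZeroPart hu
    obtain ⟨w', -, rfl⟩ := exists_mem_holPart_of_mem_oneZeroPart hu'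
    rw [liftBaseChange_one_tmul_sub_I_tmul, liftBaseChange_one_tmul_sub_I_tmul] at h
    obtain rfl : w = w' := smul_right_injective W (two_ne_zero : (2 : ℂ) ≠ 0) h
    rfl
  rw [← LinearMap.finrank_range_of_inj hinj, LinearMap.range_domRestrict,
    oneZeroPart_map_liftBaseChange]

theorem oneZeroPart_le_skewOrthogonal {Ω : W →ₗ[ℂ] W →ₗ[ℂ] ℂ} {T : Submodule ℝ W}
    (h : ∀ v ∈ holPart T, ∀ w ∈ holPart T, Ω v w = 0) :
    oneZeroPart T ≤ skewOrthogonal Ω (oneZeroPart T) := by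
  rw [← oneZeroPart_map_liftBaseChange] at h
  exact fun u hu => ⟨hu.2, fun u' hu' => h _ ⟨u, hu, rfl⟩ _ ⟨u', hu', rfl⟩⟩

end OneZero

/-! ### Functions with vanishing derivative -/

section Constant

variable {E M F : Type*} [NormedAddCommGroup E] [NormedSpace ℝ E] [TopologicalSpace M]
  [ChartedSpace E M] [IsManifold 𝓘(ℝ, E) 1 M] [NormedAddCommGroup F] [NormedSpace ℝ F] {f : M → F}

theorem eventually_eq_of_modelDeriv_eq_zero {x : M}
    (hf : ∀ᶠ y in 𝓝 x, MDifferentiableAt 𝓘(ℝ, E) 𝓘(ℝ, F) f y ∧ modelDeriv ℝ E F f y = 0) :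
    ∀ᶠ y in 𝓝 x, f y = f x := by
  set φ := extChartAt 𝓘(ℝ, E) x
  have hφφ : φ.symm (φ x) = x := extChartAt_to_inv x
  have hsymm : Tendsto φ.symm (𝓝 (φ x)) (𝓝 x) :=
    (continuousAt_extChartAt_symm x).tendsto.trans_eq (congrArg 𝓝 hφφ)
  obtain ⟨r, hr, hball⟩ := Metric.eventually_nhds_iff_ball.1
    (Eventually.and (extChartAt_target_mem_nhds x) (hsymm.eventually hf))
  have hcomp : ∀ e ∈ Metric.ball (φ x) r, DifferentiableAt ℝ (fun e => f (φ.symm e)) e ∧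
      fderiv ℝ (fun e => f (φ.symm e)) e = 0 := by
    intro e he
    obtain ⟨het, hfe, hfe0⟩ := hball e he
    have hφe : MDifferentiableAt 𝓘(ℝ, E) 𝓘(ℝ, E) φ.symm e :=
      (mdifferentiableOn_extChartAt_symm e het).mdifferentiableAt
        ((isOpen_extChartAt_target x).mem_nhds het)
    refine ⟨(hfe.comp e hφe).differentiableAt, ?_⟩
    rw [← modelDeriv_eq_fderiv, modelDeriv_comp e hfe hφe, hfe0, ContinuousLinearMap.zero_comp]
  filter_upwards [extChartAt_source_mem_nhds (I := 𝓘(ℝ, E)) x,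
    (continuousAt_extChartAt (I := 𝓘(ℝ, E)) x).preimage_mem_nhds (Metric.ball_mem_nhds _ hr)]
    with y hy hyr
  have hconst := Metric.isOpen_ball.is_const_of_fderiv_eq_zero (convex_ball _ _).isPreconnected
    (fun e he => (hcomp e he).1.differentiableWithinAt) (fun e he => (hcomp e he).2) hyr
    (Metric.mem_ball_self hr)
  rwa [φ.left_inv hy, hφφ] at hconst

theorem eq_of_modelDeriv_eq_zero {s : Set M} (hs : IsOpen s) (hs' : IsPreconnected s)
    (hf : ∀ y ∈ s, MDifferentiableAt 𝓘(ℝ, E) 𝓘(ℝ, F) f y ∧ modelDeriv ℝ E F f y = 0)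
    {x y : M} (hx : x ∈ s) (hy : y ∈ s) : f x = f y :=
  eq_of_germ_isConstant_on (fun z hz => ⟨f z, eventually_eq_of_modelDeriv_eq_zero <|
    mem_of_superset (hs.mem_nhds hz) hf⟩) hs' hx hy

end Constant

/-! ### The orbits of the real group -/

section RealOrbit

variable {E₀ : Type*} [NormedAddCommGroup E₀] [NormedSpace ℝ E₀]
  {G₀ : Type*} [TopologicalSpace G₀] [ChartedSpace E₀ G₀] [Group G₀]
  {E : Type u} [NormedAddCommGroup E] [NormedSpace ℂ E]
  {G : Type*} [TopologicalSpace G] [ChartedSpace E G] [Group G] [LieGroup 𝓘(ℂ, E) ∞ G]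
  {ι : G₀ →* G}

namespace IsComplexification

theorem isOrbitMap_coadj (hι : IsComplexification E₀ E ι) (z : E →L[ℂ] ℂ) :
    IsOrbitMap E₀ (fun h => (coadjEquiv E (ι h)).restrictScalars ℝ) (fun h => coadj (ι h) z) where
  contMDiff :=
    (contMDiff_real_of_complex (CoadjointCR.isOrbitMap_coadj z).contMDiff).comp hι.contMDiff
  map_mul x h := by
    rw [map_mul]
    exact coadj_mul _ _ _

variable [LieGroup 𝓘(ℝ, E₀) ∞ G₀] [FiniteDimensional ℂ E]

theorem range_modelDeriv_coadj (hι : IsComplexification E₀ E ι) (z : E →L[ℂ] ℂ) (h : G₀) :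
    (modelDeriv ℝ E₀ (E →L[ℂ] ℂ) (fun h => coadj (ι h) z) h).range =
      (differentialAtOne E₀ E ι).range.map ((sharp G (coadj (ι h) z)).restrictScalars ℝ) := by
  rw [range_modelDeriv_eq_range_modelDeriv_mul_left
    ((hι.isOrbitMap_coadj z).contMDiff.mdifferentiable (by simp)), ← LinearMap.range_comp]
  simp only [map_mul, coadj_mul]
  refine congrArg LinearMap.range (LinearMap.ext fun X => ?_)
  refine (modelDeriv_comp_monoidHom_one (F := fun g => coadj g (coadj (ι h) z))
    ((CoadjointCR.isOrbitMap_coadj _).contMDiff.mdifferentiable (by simp) 1)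
    (hι.contMDiff.mdifferentiable (by simp) 1) X).trans ?_
  exact modelDeriv_coadj_one _ _

/-! ### Casimir functions -/

variable {U : Set (E →L[ℂ] ℂ)} {g : (E →L[ℂ] ℂ) → ℂ}

theorem modelDeriv_casimir_coadj (hι : IsComplexification E₀ E ι) (hU : IsOpen U)
    (hg : IsHolomorphicCasimir G U g) {w : E →L[ℂ] ℂ} {h : G₀} (hw : coadj (ι h) w ∈ U) :
    MDifferentiableAt 𝓘(ℝ, E₀) 𝓘(ℝ, ℂ) (fun h => g (coadj (ι h) w)) h ∧
      modelDeriv ℝ E₀ ℂ (fun h => g (coadj (ι h) w)) h = 0 := by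
  have hgw : MDifferentiableAt 𝓘(ℂ, E →L[ℂ] ℂ) 𝓘(ℂ, ℂ) g (coadj (ι h) w) :=
    (hg.holomorphic.differentiableAt (hU.mem_nhds hw)).mdifferentiableAt
  have hgw' := (hasMFDerivAt_real_of_complex hgw).mdifferentiableAt
  have horbit : MDifferentiableAt 𝓘(ℝ, E₀) 𝓘(ℝ, E →L[ℂ] ℂ) (fun h => coadj (ι h) w) h :=
    (hι.isOrbitMap_coadj w).contMDiff.mdifferentiable (by simp) h
  refine ⟨hgw'.comp h horbit, ContinuousLinearMap.ext fun v => ?_⟩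
  obtain ⟨X, -, hX⟩ := (hι.range_modelDeriv_coadj w h).le ⟨v, rfl⟩
  rw [modelDeriv_comp h hgw' horbit, modelDeriv_real_of_complex hgw, modelDeriv_eq_fderiv]
  exact (congrArg _ hX).symm.trans (hg.casimir _ hw X)

theorem eventually_casimir_coadj_eq (hι : IsComplexification E₀ E ι) (hU : IsOpen U)
    (hg : IsHolomorphicCasimir G U g) {w : E →L[ℂ] ℂ} (hw : w ∈ U) :
    ∀ᶠ h in 𝓝 (1 : G₀), coadj (ι h) w ∈ U ∧ ∀ᶠ w' in 𝓝 w, g (coadj (ι h) w') = g w' := by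
  have hcont : Continuous fun p : G₀ × (E →L[ℂ] ℂ) => coadj (ι p.1) p.2 :=
    continuous_snd.clm_comp
      (contMDiff_Ad.continuous.comp (hι.contMDiff.continuous.comp continuous_fst))
  have hmem : (fun p : G₀ × (E →L[ℂ] ℂ) => coadj (ι p.1) p.2) ⁻¹' U ∈ 𝓝 (1, w) :=
    (hU.preimage hcont).mem_nhds (by rwa [mem_preimage, map_one, coadj_one])
  obtain ⟨N, U', hN, h1N, hU', hwU', hNU'⟩ := mem_nhds_prod_iff'.1 hmem
  have : LocallyConnectedSpace G₀ := ChartedSpace.locallyConnectedSpace E₀ G₀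
  filter_upwards [hN.connectedComponentIn.mem_nhds (mem_connectedComponentIn h1N)] with h hh
  have hNU {k : G₀} (hk : k ∈ connectedComponentIn N 1) {w'} (hw' : w' ∈ U') :
      coadj (ι k) w' ∈ U := hNU' (mk_mem_prod (connectedComponentIn_subset N 1 hk) hw')
  refine ⟨hNU hh hwU', mem_of_superset (hU'.mem_nhds hwU') fun w' hw' => ?_⟩
  have : IsManifold 𝓘(ℝ, E₀) 1 G₀ := .of_le (n := ∞) (by simp)
  have hconst := eq_of_modelDeriv_eq_zero hN.connectedComponentIn
    isPreconnected_connectedComponentIn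
    (fun k hk => hι.modelDeriv_casimir_coadj hU hg (hNU hk hw')) hh (mem_connectedComponentIn h1N)
  rwa [map_one, coadj_one] at hconst

theorem eventually_tilde_coadj_eq (hι : IsComplexification E₀ E ι) (hU : IsOpen U)
    (hg : IsHolomorphicCasimir G U g) {w : E →L[ℂ] ℂ} (hw : w ∈ U) :
    ∀ᶠ h in 𝓝 (1 : G₀), hι.tilde g (coadj (ι h) w) = hι.tilde g w := by
  filter_upwards [hι.eventually_casimir_coadj_eq hU hg hw] with h ⟨hh, heq⟩
  have hgh : DifferentiableAt ℂ g (coadjEquiv E (ι h) w) :=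
    hg.holomorphic.differentiableAt (hU.mem_nhds hh)
  have hchain : fderiv ℂ g w =
      (fderiv ℂ g (coadj (ι h) w)).comp (coadjEquiv E (ι h) : (E →L[ℂ] ℂ) →L[ℂ] (E →L[ℂ] ℂ)) :=
    (EventuallyEq.fderiv_eq heq).symm.trans
      (hgh.hasFDerivAt.comp w (coadjEquiv E (ι h)).hasFDerivAt).fderiv
  rw [tilde, tilde, hι.conjDual_coadj, hchain]
  rfl

theorem tilde_coadj_eq (hι : IsComplexification E₀ E ι) (hU : IsOpen U)
    (hg : IsHolomorphicCasimir G U g) {z : E →L[ℂ] ℂ} (hz : z ∈ U) {h : G₀}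
    (hh : h ∈ connectedComponentIn {h : G₀ | coadj (ι h) z ∈ U} 1) :
    hι.tilde g (coadj (ι h) z) = hι.tilde g z := by
  have : ContinuousMul G₀ := continuousMul_of_contMDiffMul 𝓘(ℝ, E₀) ∞
  have h1 : (1 : G₀) ∈ {h : G₀ | coadj (ι h) z ∈ U} := by
    rwa [mem_ofPred_eq, map_one, coadj_one]
  have hlocal : ∀ k ∈ connectedComponentIn {h : G₀ | coadj (ι h) z ∈ U} 1,
      ((fun h => hι.tilde g (coadj (ι h) z) : G₀ → ℂ) : Germ (𝓝 k) ℂ).IsConstant := by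
    intro k hk
    refine ⟨hι.tilde g (coadj (ι k) z), ?_⟩
    have hkU : coadj (ι k) z ∈ U :=
      connectedComponentIn_subset {h : G₀ | coadj (ι h) z ∈ U} 1 hk
    have hshift : Tendsto (fun y : G₀ => k⁻¹ * y) (𝓝 k) (𝓝 1) := by
      simpa only [inv_mul_cancel] using (continuous_const_mul k⁻¹).tendsto k
    filter_upwards [hshift.eventually (hι.eventually_tilde_coadj_eq hU hg hkU)] with y hy
    rwa [← coadj_mul, ← map_mul, mul_inv_cancel_left] at hy
  have hconst := eq_of_germ_isConstant_on hlocal isPreconnected_connectedComponentIn hh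
    (mem_connectedComponentIn h1)
  simpa only [map_one, coadj_one] using hconst

end IsComplexification

end RealOrbit

/-! ### Orbits as immersed submanifolds -/

namespace ImmersedSubmanifold

section IsOrbit

variable {𝕜 : Type} [RCLike 𝕜] {V : Type u} [NormedAddCommGroup V] [NormedSpace 𝕜 V]
  {S : ImmersedSubmanifold 𝕜 V} {E : Type*} [NormedAddCommGroup E] [NormedSpace 𝕜 E]
  {H : Type*} [TopologicalSpace H] [ChartedSpace E H] {f : H → V}

theorem IsOrbit.exists_incl_eq (hS : S.IsOrbit E f) (x : S.Carrier) : ∃ h, S.incl x = f h := by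
  obtain ⟨p, hsurj, -, -, hp⟩ := hS
  obtain ⟨h, rfl⟩ := hsurj x
  exact ⟨h, hp h⟩

theorem IsOrbit.tangentSpace_eq (hS : S.IsOrbit E f) {x : S.Carrier} {h : H}
    (hx : S.incl x = f h) : S.tangentSpace x = (modelDeriv 𝕜 E V f h).range := by
  obtain ⟨p, -, hsmooth, hsubm, hp⟩ := hS
  obtain rfl : x = p h := S.incl_injective (hx.trans (hp h).symm)
  have hsubm' : (modelDeriv 𝕜 E S.Model p h).range = ⊤ := LinearMap.range_eq_top.2 (hsubm h)
  rw [← funext hp, modelDeriv_comp h (S.incl_contMDiff.mdifferentiable (by simp) _)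
    (hsmooth.mdifferentiable (by simp) h)]
  exact (LinearMap.range_comp_of_range_eq_top _ hsubm').symm

end IsOrbit

section RealInComplex

variable {V : Type u} [NormedAddCommGroup V] [NormedSpace ℂ V]
  {M : ImmersedSubmanifold ℂ V} {O : ImmersedSubmanifold ℝ V}

theorem IsOrbit.exists_contMDiff_incl_eq {E E₀ : Type*} [NormedAddCommGroup E] [NormedSpace ℂ E]
    [NormedAddCommGroup E₀] [NormedSpace ℝ E₀] [CompleteSpace E₀] {H H₀ : Type*}
    [TopologicalSpace H] [ChartedSpace E H] [TopologicalSpace H₀] [ChartedSpace E₀ H₀]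
    [IsManifold 𝓘(ℝ, E₀) ∞ H₀] {f : H → V} {φ : H₀ → H}
    (hM : M.IsOrbit E f) (hO : O.IsOrbit E₀ (fun h => f (φ h)))
    (hφ : ContMDiff 𝓘(ℝ, E₀) 𝓘(ℝ, E) ∞ φ) :
    ∃ j : O.Carrier → M.Carrier, ContMDiff 𝓘(ℝ, O.Model) 𝓘(ℝ, M.Model) ∞ j ∧
      ∀ y, M.incl (j y) = O.incl y := by
  obtain ⟨p, -, hp, -, hincl⟩ := hM
  obtain ⟨q, hq_surj, hq, hq_subm, (hincl' : ∀ h, O.incl (q h) = f (φ h))⟩ := hO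
  choose σ hσ using hq_surj
  have hjq (h : H₀) : p (φ (σ (q h))) = p (φ h) :=
    M.incl_injective (by rw [hincl, hincl, ← hincl', hσ, hincl'])
  refine ⟨fun y => p (φ (σ y)), contMDiff_of_comp_submersion hq (fun y => ⟨σ y, hσ y⟩) hq_subm ?_,
    fun y => by rw [hincl, ← hincl', hσ]⟩
  simp only [hjq]
  exact (contMDiff_real_of_complex hp).comp hφ

variable {j : O.Carrier → M.Carrier} (hj : ContMDiff 𝓘(ℝ, O.Model) 𝓘(ℝ, M.Model) ∞ j)
  (hincl : ∀ y, M.incl (j y) = O.incl y)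
include hj hincl

theorem modelDeriv_incl_eq_comp (y : O.Carrier) :
    modelDeriv ℝ O.Model V O.incl y =
      ((modelDeriv ℂ M.Model V M.incl (j y)).restrictScalars ℝ).comp
        (modelDeriv ℝ O.Model M.Model j y) := by
  rw [← modelDeriv_real_of_complex (M.incl_contMDiff.mdifferentiable (by simp) _),
    ← modelDeriv_comp y ((contMDiff_real_of_complex M.incl_contMDiff).mdifferentiable (by simp) _)
      (hj.mdifferentiable (by simp) y), funext hincl]

theorem tangentSpace_eq_map_realTangent (y : O.Carrier) :
    O.tangentSpace y = (realTangent (EM := M.Model) (EL := O.Model) j y).map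
      ((modelDeriv ℂ M.Model V M.incl (j y)).toLinearMap.restrictScalars ℝ) := by
  refine Eq.trans ?_ (LinearMap.range_comp _ _)
  exact congrArg (fun d : O.Model →L[ℝ] V => d.range) (modelDeriv_incl_eq_comp hj hincl y)

theorem holPart_tangentSpace_eq_map (y : O.Carrier) :
    holPart (O.tangentSpace y) = (holPart (realTangent (EM := M.Model) (EL := O.Model) j y)).map
      (modelDeriv ℂ M.Model V M.incl (j y)).toLinearMap := by
  rw [tangentSpace_eq_map_realTangent hj hincl]
  exact holPart_map (M.incl_immersion (j y)) _

theorem finrank_tangentOneZero (y : O.Carrier) :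
    Module.finrank ℂ (tangentOneZero (EM := M.Model) (EL := O.Model) j y) =
      Module.finrank ℂ (holPart (O.tangentSpace y)) := by
  rw [tangentOneZero, finrank_oneZeroPart, tangentSpace_eq_map_realTangent hj hincl]
  exact (finrank_holPart_map (M.incl_immersion (j y)) _).symm

theorem isCRSubmanifold_of_finrank_holPart_tangentSpace
    (hd : ∃ d, ∀ y, Module.finrank ℂ (holPart (O.tangentSpace y)) = d) :
    IsCRSubmanifold M.Model O.Model j where
  injective y y' h := O.incl_injective (by rw [← hincl, ← hincl, h])
  contMDiff := hj
  immersion y := by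
    have hO : Injective (modelDeriv ℝ O.Model V O.incl y) := O.incl_immersion y
    rw [modelDeriv_incl_eq_comp hj hincl] at hO
    exact Injective.of_comp hO
  finrank_const := hd.imp fun d hd y => (finrank_tangentOneZero hj hincl y).trans (hd y)

end RealInComplex

theorem tangentOneZero_le_skewOrthogonal_symplecticForm {E : Type u} [NormedAddCommGroup E]
    [NormedSpace ℂ E] [FiniteDimensional ℂ E] {G : Type*} [TopologicalSpace G] [ChartedSpace E G]
    [Group G] [LieGroup 𝓘(ℂ, E) ∞ G] {M : ImmersedSubmanifold ℂ (E →L[ℂ] ℂ)}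
    {O : ImmersedSubmanifold ℝ (E →L[ℂ] ℂ)} {j : O.Carrier → M.Carrier}
    (hj : ContMDiff 𝓘(ℝ, O.Model) 𝓘(ℝ, M.Model) ∞ j) (hincl : ∀ y, M.incl (j y) = O.incl y)
    {y : O.Carrier} (h : ∀ v ∈ holPart (O.tangentSpace y), ∀ w ∈ holPart (O.tangentSpace y),
      leafForm G (O.incl y) v w = 0) :
    tangentOneZero (EM := M.Model) (EL := O.Model) j y ≤
      skewOrthogonal (symplecticForm G M (j y))
        (tangentOneZero (EM := M.Model) (EL := O.Model) j y) := by
  rw [holPart_tangentSpace_eq_map hj hincl, ← hincl] at h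
  exact oneZeroPart_le_skewOrthogonal fun v hv w hw => h _ ⟨v, hv, rfl⟩ _ ⟨w, hw, rfl⟩

end ImmersedSubmanifold

/-! ### The orbits of the real group are CR-isotropic -/

section Main

variable {E₀ : Type*} [NormedAddCommGroup E₀] [NormedSpace ℝ E₀]
  {G₀ : Type*} [TopologicalSpace G₀] [ChartedSpace E₀ G₀] [Group G₀] [LieGroup 𝓘(ℝ, E₀) ∞ G₀]
  {E : Type u} [NormedAddCommGroup E] [NormedSpace ℂ E]
  {G : Type*} [TopologicalSpace G] [ChartedSpace E G] [Group G] [LieGroup 𝓘(ℂ, E) ∞ G]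
  {ι : G₀ →* G} {z : E →L[ℂ] ℂ}

namespace IsComplexification

theorem finrank_holPart_range_modelDeriv_coadj (hι : IsComplexification E₀ E ι) (h : G₀) :
    Module.finrank ℂ (holPart (modelDeriv ℝ E₀ (E →L[ℂ] ℂ) (fun h => coadj (ι h) z) h).range) =
      Module.finrank ℂ
        (holPart (modelDeriv ℝ E₀ (E →L[ℂ] ℂ) (fun h => coadj (ι h) z) 1).range) := by
  rw [(hι.isOrbitMap_coadj z).range_modelDeriv h]
  exact finrank_holPart_map (L := (coadjEquiv E (ι h)).toLinearMap) (coadjEquiv E (ι h)).injective _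

variable {O : ImmersedSubmanifold ℝ (E →L[ℂ] ℂ)}

theorem finrank_holPart_tangentSpace (hι : IsComplexification E₀ E ι)
    (hO : O.IsOrbit E₀ (fun h : G₀ => coadj (ι h) z)) :
    ∃ d, ∀ y, Module.finrank ℂ (holPart (O.tangentSpace y)) = d := by
  refine ⟨Module.finrank ℂ
    (holPart (modelDeriv ℝ E₀ (E →L[ℂ] ℂ) (fun h => coadj (ι h) z) 1).range), fun y => ?_⟩
  obtain ⟨h, hh⟩ := hO.exists_incl_eq y
  rw [hO.tangentSpace_eq hh, hι.finrank_holPart_range_modelDeriv_coadj]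

variable [FiniteDimensional ℂ E]

theorem tangentSpace_eq_map_sharp (hι : IsComplexification E₀ E ι)
    (hO : O.IsOrbit E₀ (fun h : G₀ => coadj (ι h) z)) (y : O.Carrier) :
    O.tangentSpace y =
      (differentialAtOne E₀ E ι).range.map ((sharp G (O.incl y)).restrictScalars ℝ) := by
  obtain ⟨h, hh⟩ := hO.exists_incl_eq y
  rw [hO.tangentSpace_eq hh, hι.range_modelDeriv_coadj, hh]

theorem leafForm_eq_zero_of_mem_holPart (hι : IsComplexification E₀ E ι) (hz : z ∉ Sing E G)
    {v w : E →L[ℂ] ℂ}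
    (hv : v ∈ holPart ((differentialAtOne E₀ E ι).range.map ((sharp G z).restrictScalars ℝ)))
    (hw : w ∈ holPart ((differentialAtOne E₀ E ι).range.map ((sharp G z).restrictScalars ℝ))) :
    leafForm G z v w = 0 := by
  obtain ⟨⟨_, ⟨X, rfl⟩, rfl⟩, ⟨_, ⟨X', rfl⟩, hX⟩⟩ := hv
  obtain ⟨⟨_, ⟨Y, rfl⟩, rfl⟩, ⟨_, ⟨Y', rfl⟩, hY⟩⟩ := hw
  exact (leafForm_sharp z _ _).trans (hι.apply_bracket_eq_zero_of_sharp_eq_I_smul hz hX hY)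

theorem leafForm_eq_zero_of_mem_holPart_tangentSpace (hι : IsComplexification E₀ E ι)
    (hz : z ∉ Sing E G) (hO : O.IsOrbit E₀ (fun h : G₀ => coadj (ι h) z)) (y : O.Carrier) :
    ∀ v ∈ holPart (O.tangentSpace y), ∀ w ∈ holPart (O.tangentSpace y),
      leafForm G (O.incl y) v w = 0 := by
  rw [hι.tangentSpace_eq_map_sharp hO]
  obtain ⟨h, hh⟩ := hO.exists_incl_eq y
  exact fun v hv w hw =>
    hι.leafForm_eq_zero_of_mem_holPart (hh ▸ coadj_notMem_Sing hz (ι h)) hv hw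

theorem exists_immersedSubmanifold (hι : IsComplexification E₀ E ι) (z : E →L[ℂ] ℂ) :
    ∃ O : ImmersedSubmanifold ℝ (E →L[ℂ] ℂ), O.IsOrbit E₀ (fun h : G₀ => coadj (ι h) z) := by
  have := hι.finiteDimensional
  have : CompleteSpace E₀ := FiniteDimensional.complete ℝ E₀
  have : FiniteDimensional ℝ (E →L[ℂ] ℂ) := FiniteDimensional.complexToReal _
  exact (hι.isOrbitMap_coadj z).exists_immersedSubmanifold

end IsComplexification

theorem tangentSpace_eq_charSubspace [FiniteDimensional ℂ E]
    {M : ImmersedSubmanifold ℂ (E →L[ℂ] ℂ)}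
    (hM : M.IsOrbit E (fun g : G => coadj g z)) (x : M.Carrier) :
    M.tangentSpace x = charSubspace G (M.incl x) := by
  obtain ⟨g, hg⟩ := hM.exists_incl_eq x
  rw [hM.tangentSpace_eq hg, range_modelDeriv_coadj, hg]

end Main

end CoadjointCR

end

open CoadjointCR in
theorem mainTheorem7_general
    {E₀ : Type*} [NormedAddCommGroup E₀] [NormedSpace ℝ E₀]
    {G₀ : Type*} [TopologicalSpace G₀] [ChartedSpace E₀ G₀] [Group G₀]
    [LieGroup 𝓘(ℝ, E₀) ∞ G₀]
    {E : Type u} [NormedAddCommGroup E] [NormedSpace ℂ E] [FiniteDimensional ℂ E]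
    {G : Type*} [TopologicalSpace G] [ChartedSpace E G] [Group G] [LieGroup 𝓘(ℂ, E) ∞ G]
    (ι : G₀ →* G) (hι : IsComplexification E₀ E ι) :
    (∀ z₀ : E →L[ℂ] ℂ,
      (∃ M : ImmersedSubmanifold ℂ (E →L[ℂ] ℂ), M.IsOrbit E (fun g : G => coadj g z₀)) ∧
      (∃ O : ImmersedSubmanifold ℝ (E →L[ℂ] ℂ), O.IsOrbit E₀ (fun h : G₀ => coadj (ι h) z₀)) ∧
      ∀ (M : ImmersedSubmanifold ℂ (E →L[ℂ] ℂ)) (O : ImmersedSubmanifold ℝ (E →L[ℂ] ℂ)),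
        M.IsOrbit E (fun g : G => coadj g z₀) → O.IsOrbit E₀ (fun h : G₀ => coadj (ι h) z₀) →
        (∀ x : M.Carrier, M.tangentSpace x = charSubspace G (M.incl x)) ∧
        ∃ j : O.Carrier → M.Carrier, (∀ y, M.incl (j y) = O.incl y) ∧
          IsCRSubmanifold M.Model O.Model j ∧
          (z₀ ∉ Sing E G → IsCRIsotropic M.Model O.Model (symplecticForm G M) j)) ∧
    (∀ (U : Set (E →L[ℂ] ℂ)) (g : (E →L[ℂ] ℂ) → ℂ), IsOpen U → IsHolomorphicCasimir G U g →
      ∀ z ∈ U, ∀ h ∈ connectedComponentIn {h : G₀ | coadj (ι h) z ∈ U} 1,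
        hι.tilde g (coadj (ι h) z) = hι.tilde g z) := by
  have := hι.finiteDimensional
  have : CompleteSpace E₀ := FiniteDimensional.complete ℝ E₀
  have : CompleteSpace E := FiniteDimensional.complete ℂ E
  refine ⟨fun z₀ => ⟨(isOrbitMap_coadj z₀).exists_immersedSubmanifold,
    hι.exists_immersedSubmanifold z₀, fun M O hM hO => ⟨tangentSpace_eq_charSubspace hM, ?_⟩⟩,
    fun U g hU hg z hz h hh => hι.tilde_coadj_eq hU hg hz hh⟩
  obtain ⟨j, hj, hincl⟩ := hM.exists_contMDiff_incl_eq hO hι.contMDiff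
  have hCR : IsCRSubmanifold M.Model O.Model j :=
    ImmersedSubmanifold.isCRSubmanifold_of_finrank_holPart_tangentSpace hj hincl
      (hι.finrank_holPart_tangentSpace hO)
  refine ⟨j, hincl, hCR, fun hz₀ => ⟨hCR, fun y => ?_⟩⟩
  exact ImmersedSubmanifold.tangentOneZero_le_skewOrthogonal_symplecticForm hj hincl
    (hι.leafForm_eq_zero_of_mem_holPart_tangentSpace hz₀ hO y)

open CoadjointCR in
theorem mainTheorem7
    {E₀ : Type*} [NormedAddCommGroup E₀] [NormedSpace ℝ E₀] [FiniteDimensional ℝ E₀]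
    {G₀ : Type*} [TopologicalSpace G₀] [ChartedSpace E₀ G₀] [Group G₀]
    [LieGroup 𝓘(ℝ, E₀) ∞ G₀] [SimplyConnectedSpace G₀]
    {E : Type u} [NormedAddCommGroup E] [NormedSpace ℂ E] [FiniteDimensional ℂ E]
    {G : Type*} [TopologicalSpace G] [ChartedSpace E G] [Group G]
    [LieGroup 𝓘(ℂ, E) ∞ G] [SimplyConnectedSpace G]
    (ι : G₀ →* G) (hι : IsComplexification E₀ E ι) :
    (∀ z₀ : E →L[ℂ] ℂ, z₀ ∉ Sing E G →
      (∃ M : ImmersedSubmanifold ℂ (E →L[ℂ] ℂ), M.IsOrbit E (fun g : G => coadj g z₀)) ∧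
      (∃ O : ImmersedSubmanifold ℝ (E →L[ℂ] ℂ), O.IsOrbit E₀ (fun h : G₀ => coadj (ι h) z₀)) ∧
      ∀ (M : ImmersedSubmanifold ℂ (E →L[ℂ] ℂ)) (O : ImmersedSubmanifold ℝ (E →L[ℂ] ℂ)),
        M.IsOrbit E (fun g : G => coadj g z₀) → O.IsOrbit E₀ (fun h : G₀ => coadj (ι h) z₀) →
        (∀ x : M.Carrier, M.tangentSpace x = charSubspace G (M.incl x)) ∧
        ∃ j : O.Carrier → M.Carrier, (∀ y, M.incl (j y) = O.incl y) ∧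
          IsCRIsotropic M.Model O.Model (symplecticForm G M) j) ∧
    (∀ (U : Set (E →L[ℂ] ℂ)) (g : (E →L[ℂ] ℂ) → ℂ), IsOpen U → IsHolomorphicCasimir G U g →
      ∀ z ∈ U, ∀ h ∈ connectedComponentIn {h : G₀ | coadj (ι h) z ∈ U} 1,
        hι.tilde g (coadj (ι h) z) = hι.tilde g z) := by
  have h := mainTheorem7_general ι hι
  refine ⟨fun z₀ hz₀ => ?_, h.2⟩
  obtain ⟨hM, hO, hMO⟩ := h.1 z₀
  exact ⟨hM, hO, fun M O hM hO => (hMO M O hM hO).imp_right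
    fun ⟨j, hincl, _, hiso⟩ => ⟨j, hincl, hiso hz₀⟩⟩
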